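/- Let $\mathcal M$ be a smooth closed connected Riemannian manifold of dimension $n\ge 1$, with its geodesic distance and Riemannian volume. Let $\Psi=\{\psi_{j,k}:j\ge j_0,k\in\nabla_j\}$, $\widetilde\Psi=\{\widetilde\psi_{j,k}\}$ ($j_0\in\mathbb N_0$) be a pair of biorthogonal Riesz bases of $L^2(\mathcal M)$ (wavelets) with finite index sets $\nabla_j$, $|\nabla_j|\asymp 2^{jn}$, whose primal functions are localized at scale $2^{-j}$: $\mathrm{diam}(\mathrm{supp}\,\psi_{j,k})\asymp 2^{-j}$, $\mathrm{vol}(\mathrm{supp}\,\psi_{j,k})\gtrsim 2^{-jn}$, and for some $m$, for all $j,k$, at most $m$ indices $k'\in\nabla_j$ satisfy $\mathrm{vol}(\mathrm{supp}\,\psi_{j,k}\cap\mathrm{supp}\,\psi_{j,k'})\neq0$. Let $S_{j,k}\subset\mathcal M$ be the geodesic convex hull of $\mathrm{supp}\,\psi_{j,k}$ (the smallest set containing it that contains every minimizing geodesic between any two of its points). For $J>j_0$ put $\Lambda_J=\{(j,k):j_0\le j\le J,\ k\in\nabla_j\}$. Let $r,t,t',\sigma,\widetilde d$ be real numbers with $t,t'>\frac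 r2$ and $\frac n2+\max\{t,t'\}-\frac r2<\sigma<\widetilde d+\frac n2+\frac r2$ (in the application, $\widetilde d$ is the approximation order of the dual wavelets). Write $$\ell_{jj'}=J(t+t'-r)-jt'-j't-(j+j')\widetilde d,\qquad \tau_{jj'}=a\max\{2^{-\min\{j,j'\}},\,2^{\ell_{jj'}/(2\widetilde d+r)}\},$$ $$\alpha(j')=\tfrac{t+t'-r}{\sigma-\frac n2+t'-\frac r2}J+\tfrac{\sigma-\frac n2-(t-\frac r2)}{\sigma-\frac n2+t'-\frac r2}j',\qquad \alpha'(j)=\tfrac{t+t'-r}{\sigma-\frac n2+t-\frac r2}J+\tfrac{\sigma-\frac n2-(t'-\frac r2)}{\sigma-\frac n2+t-\frac r2}j,$$ $$\beta(j')=\tfrac{t+t'-r}{\widetilde d+t'}J+\tfrac{\widetilde d+r-t}{\widetilde d+t'}j',\qquad \beta'(j)=\tfrac{t+t'-r}{\widetilde d+t}J+\tfrac{\widetilde d+r-t'}{\widetilde d+t}j.$$ The mask $\mathbf M=\mathbf M_{(J,t,t')}\in\{0,1\}^{\Lambda_J\times\Lambda_J}$ has entry $1$ at $((j,k),(j',k'))$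 if and only if $\mathrm{dist}(S_{j,k},S_{j',k'})\le\tau_{jj'}$, $j\le\alpha(j')$ and $j'\le\alpha'(j)$; $\mathbf M_{j,j'}$ denotes its $(j,j')$ block. For a bi-infinite matrix $\mathbf A$ let $\mathbf A_{\Lambda_J}$ be its restriction to $\Lambda_J\times\Lambda_J$ and $\mathbf A^\varepsilon_{\Lambda_J}=\mathbf M\odot\mathbf A_{\Lambda_J}$ (entrywise product). The regions of pairs of levels $(j,j')$, $j_0\le j,j'\le J$, are - $D_1$: $j>j'$, $j>\alpha(j')$; $\quad D_2$: $j'>j$, $j'>\alpha'(j)$; - $D_3$: $j>j'$, $\beta(j')\le j\le\alpha(j')$; $\quad D_4$: $j'>j$, $\beta'(j)\le j'\le\alpha'(j)$; - $D_5$: $\ell_{jj'}<0$, $j\le\beta(j')$, $j'\le\beta'(j)$; $\quad D_6$: $\ell_{jj'}\ge0$. Let $\mathrm{nnz}$, $\mathrm{nnz}_{\rm row}$, $\mathrm{nnz}_{\rm col}$ be the total number of nonzero entries, the maximal number in a row and the maximal number in a column. Then for every sufficiently large constant $a>1$ the following holds, with implicit constants that are independent of $J,j,j'$ (they may depend on $\mathcal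 M$, the wavelets, $r,t,t',\sigma,\widetilde d$ and $a$). 1. On $D_1\cup D_2$: $\mathrm{nnz}(\mathbf M_{j,j'})=\mathrm{nnz}_{\rm row}(\mathbf M_{j,j'})=\mathrm{nnz}_{\rm col}(\mathbf M_{j,j'})=0$. 2. On $D_3$: $\tau_{jj'}\asymp2^{-j'}$, $\mathrm{nnz}(\mathbf M_{j,j'})\lesssim2^{jn}$, $\mathrm{nnz}_{\rm row}(\mathbf M_{j,j'})\lesssim1$, $\mathrm{nnz}_{\rm col}(\mathbf M_{j,j'})\lesssim2^{(j-j')n}$. 3. On $D_4$: $\tau_{jj'}\asymp2^{-j}$, $\mathrm{nnz}(\mathbf M_{j,j'})\lesssim2^{j'n}$, $\mathrm{nnz}_{\rm row}(\mathbf M_{j,j'})\lesssim2^{(j'-j)n}$, $\mathrm{nnz}_{\rm col}(\mathbf M_{j,j'})\lesssim1$. 4. On $D_5$: $\tau_{jj'}\asymp2^{\ell_{jj'}/(2\widetilde d+r)}$, $\mathrm{nnz}(\mathbf M_{j,j'})\lesssim2^{(j+j')n}\tau_{jj'}^n$, $\mathrm{nnz}_{\rm row}(\mathbf M_{j,j'})\lesssim2^{j'n}\tau_{jj'}^n$,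 $\mathrm{nnz}_{\rm col}(\mathbf M_{j,j'})\lesssim2^{jn}\tau_{jj'}^n$. 5. On $D_6$: $(\mathbf A^\varepsilon_{\Lambda_J})_{j,j'}=(\mathbf A_{\Lambda_J})_{j,j'}$ for every bi-infinite matrix $\mathbf A$, $\mathrm{nnz}(\mathbf M_{j,j'})\lesssim2^{(j+j')n}$, $\mathrm{nnz}_{\rm row}(\mathbf M_{j,j'})\asymp2^{j'n}$, $\mathrm{nnz}_{\rm col}(\mathbf M_{j,j'})\lesssim2^{jn}$. Moreover $|\Lambda_J|\asymp2^{Jn}$ and $$\mathrm{nnz}(\mathbf M)\lesssim2^{Jn},\qquad \mathrm{nnz}_{\rm row}(\mathbf M)\lesssim2^{Jn\frac{t+t'-r}{\sigma-n/2+t-r/2}},\qquad \mathrm{nnz}_{\rm col}(\mathbf M)\lesssim2^{Jn\frac{t+t'-r}{\sigma-n/2+t'-r/2}}.$$ -/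

import Mathlib

open MeasureTheory Set
open scoped Manifold ContDiff Bundle

noncomputable section

namespace WaveletCompression

/-! ### Convex hulls and distances of subsets -/

section Metric

variable {M : Type*} [MetricSpace M]

/-- `K` contains every minimizing geodesic between any two of its points: in a complete Riemannian
manifold, the points `z` with `d(x,z) + d(z,y) = d(x,y)` are exactly the points that lie on some
minimizing geodesic from `x` to `y`. -/
def GeodesicallyConvex (K : Set M) : Prop :=
  ∀ x ∈ K, ∀ y ∈ K, ∀ z : M, dist x z + dist z y = dist x y → z ∈ K

/-- The (geodesic) convex hull in `M`: the smallest geodesically convex set containing `A`. -/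
def geodesicHull (A : Set M) : Set M :=
  ⋂₀ {K : Set M | A ⊆ K ∧ GeodesicallyConvex K}

/-- The distance `inf {d(x,y) : x ∈ A, y ∈ B}` of two (nonempty) sets. -/
def setDist (A B : Set M) : ℝ :=
  sInf (Set.image2 dist A B)

end Metric

/-! ### Index sets -/

/-- The wavelet indices `λ = (j,k)` with `j ≥ j₀` and `k ∈ ∇_j = κ j`. -/
abbrev WaveletIndex (κ : ℕ → Type*) (j₀ : ℕ) := Σ j : Set.Ici j₀, κ j

/-- The finite set `Λ_J` of the wavelet indices `(j,k)` with `j₀ ≤ j ≤ J`. -/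
abbrev TruncIndex (κ : ℕ → Type*) (j₀ J : ℕ) := Σ j : Finset.Icc j₀ J, κ j

/-- The inclusion of `Λ_J` in the set of all wavelet indices. -/
def TruncIndex.toIndex {κ : ℕ → Type*} {j₀ J : ℕ} (l : TruncIndex κ j₀ J) : WaveletIndex κ j₀ :=
  ⟨⟨l.1, (Finset.mem_Icc.1 l.1.2).1⟩, l.2⟩

/-! ### Wavelets -/

/-- A pair of biorthogonal wavelet bases of `L²(M)`, where `M` is an `n`-dimensional Riemannian
manifold with its volume measure (the normalized `n`-dimensional Hausdorff measure): a pair of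
biorthogonal Riesz bases `(ψ, ψd)`, with `≍ 2^{jn}` indices at level `j`, such that the primal
wavelets of level `j` are localized at scale `2^{-j}` and overlap boundedly.
The support of a function is the closure of the set where it does not vanish (`tsupport`). -/
structure BiorthogonalWavelets (M : Type*) [MetricSpace M] [MeasurableSpace M] [BorelSpace M]
    (n : ℕ) (κ : ℕ → Type*) [∀ j, Fintype (κ j)] where
  /-- the coarsest level -/
  j₀ : ℕ
  /-- the primal wavelets -/
  ψ : WaveletIndex κ j₀ → M → ℝ
  /-- the dual wavelets -/
  ψd : WaveletIndex κ j₀ → M → ℝ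
  memLp : ∀ l, MemLp (ψ l) 2 μHE[n]
  memLp_dual : ∀ l, MemLp (ψd l) 2 μHE[n]
  biorthogonal : ∀ l, ∫ x, ψ l x * ψd l x ∂μHE[n] = 1
  biorthogonal_ne : ∀ l l', l ≠ l' → ∫ x, ψ l x * ψd l' x ∂μHE[n] = 0
  stable : ∃ C : ℝ, 0 < C ∧ ∀ u : M → ℝ, MemLp u 2 μHE[n] →
    Summable (fun l => (∫ x, u x * ψd l x ∂μHE[n]) ^ 2) ∧
    C⁻¹ * ∫ x, u x ^ 2 ∂μHE[n] ≤ ∑' l, (∫ x, u x * ψd l x ∂μHE[n]) ^ 2 ∧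
    ∑' l, (∫ x, u x * ψd l x ∂μHE[n]) ^ 2 ≤ C * ∫ x, u x ^ 2 ∂μHE[n]
  stable_dual : ∃ C : ℝ, 0 < C ∧ ∀ u : M → ℝ, MemLp u 2 μHE[n] →
    Summable (fun l => (∫ x, u x * ψ l x ∂μHE[n]) ^ 2) ∧
    C⁻¹ * ∫ x, u x ^ 2 ∂μHE[n] ≤ ∑' l, (∫ x, u x * ψ l x ∂μHE[n]) ^ 2 ∧
    ∑' l, (∫ x, u x * ψ l x ∂μHE[n]) ^ 2 ≤ C * ∫ x, u x ^ 2 ∂μHE[n]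
  card_level : ∃ C : ℝ, 0 < C ∧ ∀ j : ℕ, j₀ ≤ j →
    C⁻¹ * 2 ^ (j * n) ≤ (Fintype.card (κ j) : ℝ) ∧ (Fintype.card (κ j) : ℝ) ≤ C * 2 ^ (j * n)
  diam_supp : ∃ C : ℝ, 0 < C ∧ ∀ l : WaveletIndex κ j₀,
    C⁻¹ * (2 ^ (l.1 : ℕ))⁻¹ ≤ Metric.diam (tsupport (ψ l)) ∧
    Metric.diam (tsupport (ψ l)) ≤ C * (2 ^ (l.1 : ℕ))⁻¹
  vol_supp : ∃ c : ℝ, 0 < c ∧ ∀ l : WaveletIndex κ j₀,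
    ENNReal.ofReal (c * (2 ^ ((l.1 : ℕ) * n))⁻¹) ≤ μHE[n] (tsupport (ψ l))
  overlap : ∃ m : ℕ, ∀ (j : Set.Ici j₀) (k : κ j),
    {k' : κ j | μHE[n] (tsupport (ψ ⟨j, k⟩) ∩ tsupport (ψ ⟨j, k'⟩)) ≠ 0}.ncard ≤ m

/-! ### Numbers of nonzero entries -/

section Nnz

variable {m m' : Type*} [Fintype m] [Fintype m']

/-- The number of nonzero entries of a matrix. -/
def nnz (B : Matrix m m' ℝ) : ℕ :=
  {p : m × m' | B p.1 p.2 ≠ 0}.ncard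

/-- The maximal number of nonzero entries of a row. -/
def nnzRow (B : Matrix m m' ℝ) : ℕ :=
  Finset.univ.sup fun i => {j : m' | B i j ≠ 0}.ncard

/-- The maximal number of nonzero entries of a column. -/
def nnzCol (B : Matrix m m' ℝ) : ℕ :=
  Finset.univ.sup fun j => {i : m | B i j ≠ 0}.ncard

end Nnz

/-- The `(j,j')` block of a matrix indexed by `Λ_J × Λ_J`. -/
def block {κ : ℕ → Type*} {j₀ J : ℕ} (B : Matrix (TruncIndex κ j₀ J) (TruncIndex κ j₀ J) ℝ)
    (j j' : Finset.Icc j₀ J) : Matrix (κ j) (κ j') ℝ :=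
  fun k k' => B ⟨j, k⟩ ⟨j', k'⟩

/-! ### The compression -/

/-- The real parameters of the compression: the order `r` of the operator, the exponents `t`, `t'`
of the error norm `H^t → H^{-t'}`, the decay parameter `σ` and the dual approximation order `dd`. -/
structure Params where
  r : ℝ
  t : ℝ
  t' : ℝ
  σ : ℝ
  dd : ℝ

namespace Params

variable (P : Params) (n J : ℕ)

/-- The right hand side of the slope condition that bounds `j` in terms of `j'`. -/
def slopeRow (j' : ℕ) : ℝ :=
  (P.t + P.t' - P.r) / (P.σ - n / 2 + P.t' - P.r / 2) * J
    + (P.σ - n / 2 - (P.t - P.r / 2)) / (P.σ - n / 2 + P.t' - P.r / 2) * j'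

/-- The right hand side of the slope condition that bounds `j'` in terms of `j`. -/
def slopeCol (j : ℕ) : ℝ :=
  (P.t + P.t' - P.r) / (P.σ - n / 2 + P.t - P.r / 2) * J
    + (P.σ - n / 2 - (P.t' - P.r / 2)) / (P.σ - n / 2 + P.t - P.r / 2) * j

/-- The number `J(t+t'-r) - jt' - j't - (j+j')d̃`. -/
def level (j j' : ℕ) : ℝ :=
  J * (P.t + P.t' - P.r) - j * P.t' - j' * P.t - (j + j') * P.dd

/-- The line that separates the regions `D₃` and `D₅`, as a bound for `j`. -/
def cutRow (j' : ℕ) : ℝ :=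
  (P.t + P.t' - P.r) / (P.dd + P.t') * J + (P.dd + P.r - P.t) / (P.dd + P.t') * j'

/-- The line that separates the regions `D₄` and `D₅`, as a bound for `j'`. -/
def cutCol (j : ℕ) : ℝ :=
  (P.t + P.t' - P.r) / (P.dd + P.t) * J + (P.dd + P.r - P.t') / (P.dd + P.t) * j

/-- The threshold `τ_{jj'}`, with constant `a`. -/
def tau (a : ℝ) (j j' : ℕ) : ℝ :=
  a * max ((2 : ℝ) ^ (-(min j j' : ℕ) : ℝ)) ((2 : ℝ) ^ (P.level J j j' / (2 * P.dd + P.r)))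

/-- The region `D₁`. -/
def D₁ : Set (ℕ × ℕ) := {p | p.1 ≤ J ∧ p.2 < p.1 ∧ P.slopeRow n J p.2 < p.1}

/-- The region `D₂`. -/
def D₂ : Set (ℕ × ℕ) := {p | p.2 ≤ J ∧ p.1 < p.2 ∧ P.slopeCol n J p.1 < p.2}

/-- The region `D₃`. -/
def D₃ : Set (ℕ × ℕ) :=
  {p | p.1 ≤ J ∧ p.2 < p.1 ∧ p.1 ≤ P.slopeRow n J p.2 ∧ P.cutRow J p.2 ≤ p.1}

/-- The region `D₄`. -/
def D₄ : Set (ℕ × ℕ) :=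
  {p | p.2 ≤ J ∧ p.1 < p.2 ∧ p.2 ≤ P.slopeCol n J p.1 ∧ P.cutCol J p.1 ≤ p.2}

/-- The region `D₅`. -/
def D₅ : Set (ℕ × ℕ) :=
  {p | P.level J p.1 p.2 < 0 ∧ p.1 ≤ P.cutRow J p.2 ∧ p.2 ≤ P.cutCol J p.1}

/-- The region `D₆`. -/
def D₆ : Set (ℕ × ℕ) := {p | 0 ≤ P.level J p.1 p.2}

end Params

namespace BiorthogonalWavelets

variable {M : Type*} [MetricSpace M] [MeasurableSpace M] [BorelSpace M] {n : ℕ}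
  {κ : ℕ → Type*} [∀ j, Fintype (κ j)] (W : BiorthogonalWavelets M n κ)

/-- The convex hull `S_λ` of the support of the wavelet `ψ_λ`. -/
def hull (l : WaveletIndex κ W.j₀) : Set M := geodesicHull (tsupport (W.ψ l))

/-- The set `supp(J,t,t') ⊆ Λ_J × Λ_J` of retained pairs of indices. -/
def retained (P : Params) (a : ℝ) (J : ℕ) :
    Set (TruncIndex κ W.j₀ J × TruncIndex κ W.j₀ J) :=
  {p | setDist (W.hull p.1.toIndex) (W.hull p.2.toIndex) ≤ P.tau J a p.1.1 p.2.1 ∧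
    ((p.1.1 : ℕ) : ℝ) ≤ P.slopeRow n J p.2.1 ∧ ((p.2.1 : ℕ) : ℝ) ≤ P.slopeCol n J p.1.1}

open Classical in
/-- The mask `M_{(J,t,t')} ∈ {0,1}^{Λ_J × Λ_J}`. -/
def mask (P : Params) (a : ℝ) (J : ℕ) :
    Matrix (TruncIndex κ W.j₀ J) (TruncIndex κ W.j₀ J) ℝ :=
  fun l l' => if (l, l') ∈ W.retained P a J then 1 else 0

/-- The truncation `A_{Λ_J}` of a bi-infinite matrix `A`. -/
def truncate (J : ℕ) (A : Matrix (WaveletIndex κ W.j₀) (WaveletIndex κ W.j₀) ℝ) :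
    Matrix (TruncIndex κ W.j₀ J) (TruncIndex κ W.j₀ J) ℝ :=
  A.submatrix TruncIndex.toIndex TruncIndex.toIndex

/-- The compression `A^ε_{Λ_J}` of a bi-infinite matrix `A`: the entrywise product of the mask and
the truncation of `A`. -/
def compress (P : Params) (a : ℝ) (J : ℕ)
    (A : Matrix (WaveletIndex κ W.j₀) (WaveletIndex κ W.j₀) ℝ) :
    Matrix (TruncIndex κ W.j₀ J) (TruncIndex κ W.j₀ J) ℝ :=
  Matrix.hadamard (W.mask P a J) (W.truncate J A)

end BiorthogonalWavelets

end WaveletCompression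

end

/-! The geometric core is that the geodesic hull of a set of diameter `d > 0` has diameter at most a
constant times `d`. Convexity means closure under metric betweenness, and it is proved here without
the exponential map. In a chart, take a Euclidean ball about `q` and put `F u = u - s • h u • Y u`,
where `Y` is the Riemannian gradient of `‖u - q‖² / 2` and the cut-off `h` vanishes on the ball. For
small `s`, near the centre of the chart, `F` fixes the ball, does not lengthen tangent vectors, and
shrinks them by a factor below one outside each larger concentric ball (`exists_contraction`). If
`z` lay between two points `x`, `y` of the ball but outside it, images under `F` would give a chain
from `x` to `y` shorter than their distance. So small chart balls are convex
(`geodesicallyConvex_chart_ball`). As the chart is locally bi-Lipschitz, hulls of small metric balls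
lie in balls of comparable radius, and compactness makes the constants uniform
(`exists_dist_geodesicHull_le`).

The same chart bounds give volumes of balls at most `C * d ^ n` (`exists_volume_le`). If `τ` is at
least both wavelet scales, all supports of level `j'` whose hulls are within `τ` of a given hull lie
in a ball of radius `O(τ)`. Each has volume at least a multiple of `2^{-j'n}` and they overlap
boundedly, so their number is `O(2^{j'n} τ^n)` (`exists_ncard_le`). Inserting the value of the
threshold settles the blocks in `D₃`, `D₄`, `D₅`. On `D₁`, `D₂` a slope condition fails. On `D₆` the
threshold is at least `a`, hence at least the diameter of the manifold, and both slope conditions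
hold, so the block is full.

The global counts are sums of these bounds. With `A = t - r/2`, `B = t' - r/2`, `S = σ - n/2`, `D =
d̃ + r/2`, the hypotheses say `0 < A, B < S < D`. In a row, the terms are geometric up to the last
level permitted by the slope condition, except for a bounded contribution per level
(`exists_row_sum_le`). In the total, the slope conditions and `A, B < D` yield decay in both `J - j`
and `J - j'`, leaving a product of two geometric series times `2^{Jn}` (`exists_total_sum_le`). -/

noncomputable section

namespace WaveletCompression

/-! ### The pointwise contraction estimate and the cut-off function. -/

section Core
open Metric
open scoped Topology RealInnerProductSpace

variable {E : Type*} [NormedAddCommGroup E] [InnerProductSpace ℝ E]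

set_option maxHeartbeats 1000000 in
/-- The quadratic form of a perturbed metric decreases along `v ↦ v - s w`, where `w` is the
derivative of a cut-off gradient field in the direction `v`. -/
theorem metric_contraction_estimate {B B' : E →L[ℝ] E →L[ℝ] ℝ} {L ε s h p b : ℝ}
    {v Y P Q : E} (hL : 1 ≤ L) (hε0 : 0 ≤ ε) (hε : 16 * L ^ 2 * ε ≤ 1) (hs0 : 0 ≤ s)
    (hs : 16 * L ^ 3 * s ≤ 1) (hh0 : 0 ≤ h) (hh1 : h ≤ 1) (hp0 : 0 ≤ p) (hp1 : p ≤ 1)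
    (hB : ‖B‖ ≤ L) (hsymm : ∀ x y, B x y = B y x)
    (hB' : ‖B' - B‖ ≤ L * (s * h * ‖Y‖))
    (hY : ‖Y‖ ≤ L * ε) (hP : ‖P‖ ≤ L * ‖v‖ * ε) (hQ : ‖Q‖ ≤ L * ‖v‖)
    (hvQ : B v Q = ‖v‖ ^ 2) (hvY : B v Y = b) (hb : |b| ≤ ‖v‖) :
    B' (v - s • (h • (P + Q) + (p * (2 * b)) • Y)) (v - s • (h • (P + Q) + (p * (2 * b)) • Y)) ≤
      B v v - s * h * ‖v‖ ^ 2 := by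
  set w := h • (P + Q) + (p * (2 * b)) • Y with hw
  have hL0 : 0 ≤ L := by linarith
  have hε1 : ε ≤ 1 := by nlinarith [mul_nonneg hε0 (sub_nonneg.2 (one_le_pow₀ hL : 1 ≤ L ^ 2))]
  have hv := norm_nonneg v
  have hbound : ∀ x y, |B x y| ≤ L * ‖x‖ * ‖y‖ := fun x y => by
    have := B.le_opNorm₂ x y
    rw [Real.norm_eq_abs] at this
    refine this.trans ?_
    gcongr
  have hb2 : b ^ 2 ≤ ‖v‖ ^ 2 := by
    rw [← sq_abs b]; gcongr
  -- First-order gain. The derivative of the cut-off contributes a square, `2 * p * b ^ 2`, because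
  -- the gradient field represents the same linear form `b` that occurs in that derivative.
  have hvw : h * (1 - L ^ 2 * ε) * ‖v‖ ^ 2 + 2 * p * b ^ 2 ≤ B v w := by
    have h1 : B v w = h * (B v P + ‖v‖ ^ 2) + 2 * p * b ^ 2 := by
      simp only [hw, map_add, map_smul, smul_eq_mul, hvQ, hvY]; ring
    have h2 : -(L ^ 2 * ε * ‖v‖ ^ 2) ≤ B v P := by
      have h3 := (abs_le.1 (hbound v P)).1
      have h4 : L * ‖v‖ * ‖P‖ ≤ L * ‖v‖ * (L * ‖v‖ * ε) := by gcongr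
      linarith
    rw [h1]
    linarith [mul_le_mul_of_nonneg_left h2 hh0]
  have hwn : ‖w‖ ≤ 2 * L * (h * ‖v‖) + 2 * L * (p * |b|) := by
    have h1 : ‖w‖ ≤ h * (‖P‖ + ‖Q‖) + p * (2 * |b|) * ‖Y‖ := by
      refine (norm_add_le _ _).trans ?_
      rw [norm_smul, norm_smul, Real.norm_of_nonneg hh0, Real.norm_eq_abs, abs_mul, abs_mul,
        abs_of_nonneg hp0, abs_two]
      gcongr
      exact norm_add_le _ _
    refine h1.trans (add_le_add ?_ ?_)
    · have : ‖P‖ + ‖Q‖ ≤ 2 * L * ‖v‖ := by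
        have : L * ‖v‖ * ε ≤ L * ‖v‖ * 1 := by gcongr
        linarith
      calc h * (‖P‖ + ‖Q‖) ≤ h * (2 * L * ‖v‖) := by gcongr
        _ = _ := by ring
    · have : ‖Y‖ ≤ L := hY.trans (by nlinarith)
      calc p * (2 * |b|) * ‖Y‖ ≤ p * (2 * |b|) * L := by gcongr
        _ = _ := by ring
  -- `T` measures the first-order gain. Since `h ^ 2 ≤ h` and `p ^ 2 ≤ p`, also `‖w‖ ^ 2` is at most
  -- a multiple of `T`, so for small `s` the second-order term is absorbed.
  set T := h * ‖v‖ ^ 2 + p * b ^ 2 with hT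
  have hT0 : 0 ≤ T := by positivity
  have hT2 : T ≤ 2 * ‖v‖ ^ 2 := by nlinarith [sq_nonneg b, sq_nonneg ‖v‖]
  have hw2 : ‖w‖ ^ 2 ≤ 8 * L ^ 2 * T := by
    have h1 : ‖w‖ ^ 2 ≤ (2 * L * (h * ‖v‖) + 2 * L * (p * |b|)) ^ 2 := by gcongr
    have h2 : (2 * L * (h * ‖v‖) + 2 * L * (p * |b|)) ^ 2 ≤
        8 * L ^ 2 * (h ^ 2 * ‖v‖ ^ 2 + p ^ 2 * b ^ 2) := by
      rw [← sq_abs b, ← sub_nonneg]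
      have : 8 * L ^ 2 * (h ^ 2 * ‖v‖ ^ 2 + p ^ 2 * |b| ^ 2) -
          (2 * L * (h * ‖v‖) + 2 * L * (p * |b|)) ^ 2 =
          (2 * L * (h * ‖v‖) - 2 * L * (p * |b|)) ^ 2 := by ring
      rw [this]
      exact sq_nonneg _
    have h3 : h ^ 2 * ‖v‖ ^ 2 + p ^ 2 * b ^ 2 ≤ T := by
      have : h ^ 2 ≤ h := pow_le_of_le_one hh0 hh1 two_ne_zero
      have : p ^ 2 ≤ p := pow_le_of_le_one hp0 hp1 two_ne_zero
      rw [hT]; gcongr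
    calc _ ≤ _ := h1
      _ ≤ _ := h2
      _ ≤ _ := by gcongr
  have hBx : B (v - s • w) (v - s • w) = B v v - 2 * s * B v w + s ^ 2 * B w w := by
    simp only [map_sub, map_smul, _root_.sub_apply, _root_.smul_apply,
      smul_eq_mul, hsymm w v]
    ring
  have hBw : B w w ≤ L * ‖w‖ ^ 2 := by
    have := (abs_le.1 (hbound w w)).2
    linarith
  have hs3 : s ^ 2 * (8 * L ^ 3) ≤ s / 2 := by linarith [mul_le_mul_of_nonneg_right hs hs0]
  have hs2 : s ^ 2 * (16 * L ^ 2) ≤ 1 := by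
    have h1 : L ^ 2 ≤ L ^ 3 := pow_le_pow_right₀ hL (by norm_num)
    have h2 : 1 ≤ L ^ 3 := one_le_pow₀ hL
    have h3 : s ≤ 1 := by nlinarith
    exact (mul_le_mul_of_nonneg_left (by gcongr) (sq_nonneg s)).trans
      (by linarith : s ^ 2 * (16 * L ^ 3) ≤ 1)
  have hsw : s ^ 2 * ‖w‖ ^ 2 ≤ ‖v‖ ^ 2 := by
    have : s ^ 2 * ‖w‖ ^ 2 ≤ s ^ 2 * (8 * L ^ 2 * (2 * ‖v‖ ^ 2)) := by
      gcongr
      exact hw2.trans (by gcongr)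
    linarith [mul_le_mul_of_nonneg_right hs2 (sq_nonneg ‖v‖)]
  have hx : ‖v - s • w‖ ^ 2 ≤ 4 * ‖v‖ ^ 2 := by
    have h1 : ‖v - s • w‖ ≤ ‖v‖ + s * ‖w‖ := by
      refine (norm_sub_le _ _).trans ?_
      rw [norm_smul, Real.norm_of_nonneg hs0]
    have h2 : s * ‖w‖ ≤ ‖v‖ := by
      refine le_of_sq_le_sq ?_ hv
      rw [mul_pow]; exact hsw
    have h3 : ‖v - s • w‖ ≤ 2 * ‖v‖ := by linarith
    calc _ ≤ (2 * ‖v‖) ^ 2 := by gcongr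
      _ = _ := by ring
  -- The change of base point also carries the factor `h`, so the gain `s * h * ‖v‖ ^ 2` absorbs it
  -- even where the cut-off degenerates.
  have hdiff : B' (v - s • w) (v - s • w) - B (v - s • w) (v - s • w) ≤
      L * (s * h * (L * ε)) * (4 * ‖v‖ ^ 2) := by
    have h1 := (B' - B).le_opNorm₂ (v - s • w) (v - s • w)
    rw [Real.norm_eq_abs] at h1
    have h2 := (abs_le.1 h1).2
    simp only [_root_.sub_apply] at h2
    refine h2.trans ?_
    rw [mul_assoc, ← sq]
    gcongr
    exact hB'.trans (by gcongr)
  have hBw' : s ^ 2 * B w w ≤ s / 2 * T := by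
    have : s ^ 2 * B w w ≤ s ^ 2 * (L * (8 * L ^ 2 * T)) := by
      gcongr
      exact hBw.trans (by gcongr)
    linarith [mul_le_mul_of_nonneg_right hs3 hT0]
  have hvw' := mul_le_mul_of_nonneg_left hvw hs0
  have hsh : 0 ≤ s * h * ‖v‖ ^ 2 := by positivity
  have hsp : 0 ≤ s * p * b ^ 2 := by positivity
  have hεv := mul_le_mul_of_nonneg_right hε hsh
  rw [hT] at hBw'
  rw [hBx] at hdiff
  linarith

/-- The derivative of the square of the positive part. -/
theorem hasDerivAt_posPart_sq (x : ℝ) : HasDerivAt (fun y : ℝ => max 0 y ^ 2) (2 * max 0 x) x := by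
  rcases lt_trichotomy x 0 with hx | rfl | hx
  · rw [max_eq_left hx.le, mul_zero]
    refine (hasDerivAt_const x (0 : ℝ)).congr_of_eventuallyEq ?_
    filter_upwards [Iio_mem_nhds hx] with y hy
    simp [max_eq_left (le_of_lt (mem_Iio.1 hy))]
  · rw [max_self, mul_zero, hasDerivAt_iff_isLittleO]
    simp only [max_self, smul_zero, sub_zero, ne_eq, OfNat.ofNat_ne_zero, not_false_eq_true,
      zero_pow]
    refine Asymptotics.IsBigO.trans_isLittleO (g := fun y : ℝ => y ^ 2) ?_
      (Asymptotics.isLittleO_pow_id one_lt_two)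
    refine Asymptotics.isBigO_of_le _ fun y => ?_
    rw [norm_pow, norm_pow]
    gcongr
    rw [Real.norm_of_nonneg (le_max_left _ _), Real.norm_eq_abs]
    exact max_le (abs_nonneg _) (le_abs_self _)
  · rw [max_eq_right hx.le]
    have := hasDerivAt_pow 2 x
    simp only [Nat.cast_ofNat, Nat.add_one_sub_one, pow_one] at this
    refine this.congr_of_eventuallyEq ?_
    filter_upwards [Ioi_mem_nhds hx] with y hy
    rw [max_eq_right (le_of_lt (mem_Ioi.1 hy))]

/-- Squaring removes the kink of the positive part. Class `C^1` is enough, as the Riemannian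
distance is an infimum over `C^1` paths. -/
theorem contDiff_posPart_sq : ContDiff ℝ 1 (fun y : ℝ => max 0 y ^ 2) := by
  rw [contDiff_one_iff_deriv]
  refine ⟨fun x => (hasDerivAt_posPart_sq x).differentiableAt, ?_⟩
  have : deriv (fun y : ℝ => max 0 y ^ 2) = fun x => 2 * max 0 x :=
    funext fun x => (hasDerivAt_posPart_sq x).deriv
  rw [this]
  fun_prop

end Core

/-! ### The contracting map of the model space. -/

section CoreField
open Metric
open scoped Topology RealInnerProductSpace NNReal

variable {E : Type*} [NormedAddCommGroup E] [InnerProductSpace ℝ E]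

set_option maxSynthPendingDepth 3 in
set_option maxHeartbeats 1000000 in
/-- Uniform bounds for a metric of class `C^1` and its inverse near a point. -/
theorem exists_metric_bounds [CompleteSpace E] {G : E → E →L[ℝ] E →L[ℝ] ℝ} {c : E}
    (hG : ContDiffAt ℝ 1 G c)
    (hco : ∃ l : ℝ, 0 < l ∧ ∀ᶠ u in 𝓝 c, ∀ v, l * ‖v‖ ^ 2 ≤ G u v v) :
    ∃ (H : E → (E →L[ℝ] ℝ) →L[ℝ] E) (L : ℝ) (N : Set E), 1 ≤ L ∧ N ∈ 𝓝 c ∧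
      (∀ u ∈ N, ∀ u' ∈ N, ‖G u' - G u‖ ≤ L * ‖u' - u‖) ∧
      ∀ u ∈ N, ‖G u‖ ≤ L ∧ ‖H u‖ ≤ L ∧ ContDiffAt ℝ 1 H u ∧ ‖fderiv ℝ H u‖ ≤ L ∧
        ∀ φ, G u (H u φ) = φ := by
  obtain ⟨l, hl, hco⟩ := hco
  have hcoer : IsCoercive (G c) := ⟨l, hl, fun v => by
    have := hco.self_of_nhds v; rwa [sq, ← mul_assoc] at this⟩
  -- Lax–Milgram: coercivity makes `G c` invertible. Inversion of operators is smooth near `G c`, so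
  -- the inverse metric is `C^1` near `c`.
  let e : E ≃L[ℝ] (E →L[ℝ] ℝ) :=
    hcoer.continuousLinearEquivOfBilin.trans
      (InnerProductSpace.toDual ℝ E).toContinuousLinearEquiv
  have he : (e : E →L[ℝ] (E →L[ℝ] ℝ)) = G c := by
    ext v w
    exact IsCoercive.continuousLinearEquivOfBilin_apply hcoer v w
  let H : E → (E →L[ℝ] ℝ) →L[ℝ] E := fun u => (G u).inverse
  have hH : ContDiffAt ℝ 1 H c := by
    have h1 : ContDiffAt ℝ 1 (ContinuousLinearMap.inverse : (E →L[ℝ] (E →L[ℝ] ℝ)) → _) (G c) := by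
      rw [← he]; exact contDiffAt_map_inverse e
    exact h1.comp c hG
  obtain ⟨K₁, t₁, ht₁, hK₁⟩ := hG.exists_lipschitzOnWith
  have hGb : ∀ᶠ u in 𝓝 c, ‖G u‖ < ‖G c‖ + 1 :=
    hG.continuousAt.norm.eventually (gt_mem_nhds (lt_add_one _))
  have hHb : ∀ᶠ u in 𝓝 c, ‖H u‖ < ‖H c‖ + 1 :=
    hH.continuousAt.norm.eventually (gt_mem_nhds (lt_add_one _))
  have hHc : ∀ᶠ u in 𝓝 c, ContDiffAt ℝ 1 H u := hH.eventually (by simp)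
  have hHf : ∀ᶠ u in 𝓝 c, ‖fderiv ℝ H u‖ < ‖fderiv ℝ H c‖ + 1 :=
    (hH.continuousAt_fderiv one_ne_zero).norm.eventually (gt_mem_nhds (lt_add_one _))
  have hinv : ∀ᶠ u in 𝓝 c, ∀ φ, G u (H u φ) = φ := by
    have h1 : ∀ᶠ A in 𝓝 (G c), A ∈ range ((↑) : (E ≃L[ℝ] (E →L[ℝ] ℝ)) → _) := by
      rw [← he]; exact ContinuousLinearEquiv.nhds e
    filter_upwards [hG.continuousAt.eventually h1] with u ⟨e', he'⟩ φ
    simp [H, ← he', ContinuousLinearMap.inverse_equiv]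
  refine ⟨H, max 1 (max K₁ (max (‖G c‖ + 1) (max (‖H c‖ + 1) (‖fderiv ℝ H c‖ + 1)))),
    t₁ ∩ {u | ‖G u‖ < ‖G c‖ + 1 ∧ ‖H u‖ < ‖H c‖ + 1 ∧ ContDiffAt ℝ 1 H u ∧
      ‖fderiv ℝ H u‖ < ‖fderiv ℝ H c‖ + 1 ∧ ∀ φ, G u (H u φ) = φ}, le_max_left _ _,
    Filter.inter_mem ht₁ (hGb.and (hHb.and (hHc.and (hHf.and hinv)))), ?_, ?_⟩
  · intro u hu u' hu'
    have := hK₁.dist_le_mul u' hu'.1 u hu.1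
    rw [dist_eq_norm, dist_eq_norm] at this
    refine this.trans ?_
    gcongr
    exact (le_max_left _ _).trans (le_max_right _ _)
  · rintro u ⟨-, h1, h2, h3, h4, h5⟩
    exact ⟨h1.le.trans (by simp), h2.le.trans (by simp), h3, h4.le.trans (by simp), h5⟩

set_option maxSynthPendingDepth 3 in
set_option maxHeartbeats 1000000 in
/-- A metric of class `C^1` is contracted by a map that fixes a given small Euclidean ball, and
strictly so outside every larger ball. -/
theorem exists_contraction [CompleteSpace E] {G : E → E →L[ℝ] E →L[ℝ] ℝ} {c : E}
    (hG : ContDiffAt ℝ 1 G c) (hsymm : ∀ᶠ u in 𝓝 c, ∀ v w, G u v w = G u w v)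
    (hco : ∃ l : ℝ, 0 < l ∧ ∀ᶠ u in 𝓝 c, ∀ v, l * ‖v‖ ^ 2 ≤ G u v v) :
    ∃ r₁ : ℝ, 0 < r₁ ∧ ∀ r : ℝ, 0 < r → r ≤ r₁ → ∀ q ∈ ball c r, ∀ ρ : ℝ, 0 < ρ →
      ∃ F : E → E, ContDiffOn ℝ 1 F (ball c r) ∧ MapsTo F (ball c r) (ball c (2 * r)) ∧
        (∀ u, dist u q ≤ ρ → F u = u) ∧
        (∀ u ∈ ball c r, ∀ v, G (F u) (fderiv ℝ F u v) (fderiv ℝ F u v) ≤ G u v v) ∧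
        ∀ ρ' > ρ, ∃ k : ℝ, 0 ≤ k ∧ k < 1 ∧ ∀ u ∈ ball c r, ρ' ≤ dist u q → ∀ v,
          G (F u) (fderiv ℝ F u v) (fderiv ℝ F u v) ≤ k ^ 2 * G u v v := by
  obtain ⟨H, L, N, hL, hN, hlip, hbd⟩ := exists_metric_bounds hG hco
  obtain ⟨r₂, hr₂, hball⟩ := Metric.mem_nhds_iff.1 (Filter.inter_mem hN hsymm)
  have hL0 : 0 < L := by linarith
  -- `r₂ / 2` keeps the image ball of radius `2 * r` where the bounds hold, `1 / 4` makes `h` and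
  -- `p` at most `1`, and the last entry is the smallness of `ε = 2 * r` in the pointwise estimate.
  refine ⟨min (r₂ / 2) (min (1 / 4) (1 / (32 * L ^ 2))), by positivity, ?_⟩
  intro r hr hrr q hq ρ hρ
  have hr2 : 2 * r ≤ r₂ := by linarith [hrr.trans (min_le_left _ _)]
  have hr4 : r ≤ 1 / 4 := hrr.trans ((min_le_right _ _).trans (min_le_left _ _))
  have hrL : 16 * L ^ 2 * (2 * r) ≤ 1 := by
    have := hrr.trans ((min_le_right _ _).trans (min_le_right _ _))
    rw [le_div_iff₀ (by positivity)] at this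
    linarith
  have hin : ∀ u ∈ ball c (2 * r), u ∈ N ∧ ∀ v w, G u v w = G u w v := fun u hu =>
    hball (ball_subset_ball hr2 hu)
  have hsub : ball c r ⊆ ball c (2 * r) := ball_subset_ball (by linarith)
  set s : ℝ := 1 / (16 * L ^ 3) with hs
  have hs0 : 0 < s := by positivity
  have hs1 : 16 * L ^ 3 * s ≤ 1 := by rw [hs]; field_simp; rfl
  have hsL : s * L ≤ 1 / 2 := by
    have : s * L ≤ s * L ^ 3 := by gcongr; exact le_self_pow₀ hL (by norm_num)
    linarith
  -- `p` is the derivative of the cut-off `h` with respect to `‖u - q‖ ^ 2`, and `Y` is the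
  -- Riemannian gradient of `‖u - q‖ ^ 2 / 2`.
  let h : E → ℝ := fun u => max 0 (‖u - q‖ ^ 2 - ρ ^ 2) ^ 2
  let p : E → ℝ := fun u => 2 * max 0 (‖u - q‖ ^ 2 - ρ ^ 2)
  let Y : E → E := fun u => H u (innerSL ℝ (u - q))
  let F : E → E := fun u => u - s • (h u • Y u)
  have hdist : ∀ u ∈ ball c r, ‖u - q‖ ≤ 2 * r := fun u hu => by
    rw [← dist_eq_norm]
    have := dist_triangle_right u q c
    rw [mem_ball] at hu hq
    linarith
  have hm : ∀ u ∈ ball c r, max 0 (‖u - q‖ ^ 2 - ρ ^ 2) ≤ 1 / 2 := fun u hu => by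
    refine max_le (by norm_num) ?_
    have : ‖u - q‖ ^ 2 ≤ (2 * r) ^ 2 := by gcongr; exact hdist u hu
    nlinarith [sq_nonneg ρ]
  have hm0 : ∀ u, 0 ≤ max 0 (‖u - q‖ ^ 2 - ρ ^ 2) := fun u => le_max_left _ _
  have hh0 : ∀ u, 0 ≤ h u := fun u => sq_nonneg _
  have hh1 : ∀ u ∈ ball c r, h u ≤ 1 := fun u hu =>
    pow_le_one₀ (hm0 u) ((hm u hu).trans (by norm_num))
  have hY : ∀ u ∈ ball c r, ‖Y u‖ ≤ L * ‖u - q‖ := fun u hu => by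
    refine ((H u).le_opNorm _).trans ?_
    rw [innerSL_apply_norm]
    gcongr
    exact (hbd u (hin u (hsub hu)).1).2.1
  have hYr : ∀ u ∈ ball c r, ‖Y u‖ ≤ L * (2 * r) := fun u hu =>
    (hY u hu).trans (by gcongr; exact hdist u hu)
  have hmove : ∀ u, ‖F u - u‖ = s * h u * ‖Y u‖ := fun u => by
    have : F u - u = -(s • (h u • Y u)) := by simp [F]
    rw [this, norm_neg, norm_smul, norm_smul, Real.norm_of_nonneg hs0.le,
      Real.norm_of_nonneg (hh0 u), mul_assoc]
  have hmaps : MapsTo F (ball c r) (ball c (2 * r)) := fun u hu => by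
    have h1 : ‖F u - u‖ ≤ r := by
      rw [hmove]
      calc s * h u * ‖Y u‖ ≤ s * 1 * (L * (2 * r)) := by
            gcongr
            · exact hh1 u hu
            · exact hYr u hu
        _ = (s * L) * (2 * r) := by ring
        _ ≤ 1 / 2 * (2 * r) := by gcongr
        _ = r := by ring
    rw [← dist_eq_norm] at h1
    rw [mem_ball] at hu ⊢
    linarith [dist_triangle (F u) u c]
  have hcd : ∀ u ∈ ball c r, ContDiffAt ℝ 1 F u := fun u hu => by
    have h1 := (hbd u (hin u (hsub hu)).1).2.2.1
    have h2 : ContDiffAt ℝ 1 h u :=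
      contDiff_posPart_sq.contDiffAt.comp (f := fun u : E => ‖u - q‖ ^ 2 - ρ ^ 2) u
        (((contDiff_norm_sq ℝ).comp (contDiff_id.sub contDiff_const)).sub contDiff_const).contDiffAt
    have h3 : ContDiffAt ℝ 1 Y u := h1.clm_apply
      ((innerSL ℝ (E := E)).contDiff.comp (contDiff_id.sub contDiff_const)).contDiffAt
    exact contDiffAt_id.sub (contDiffAt_const.smul (h2.smul h3))
  have hder : ∀ u ∈ ball c r, ∀ v, fderiv ℝ F u v = v - s • (h u •
      (fderiv ℝ H u v (innerSL ℝ (u - q)) + H u (innerSL ℝ v)) +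
        (p u * (2 * ⟪u - q, v⟫)) • Y u) := fun u hu v => by
    have h1 : HasFDerivAt H (fderiv ℝ H u) u :=
      ((hbd u (hin u (hsub hu)).1).2.2.1.differentiableAt one_ne_zero).hasFDerivAt
    have h0 : HasFDerivAt (fun u : E => u - q) (ContinuousLinearMap.id ℝ E) u :=
      (hasFDerivAt_id u).sub_const q
    have h2 : HasFDerivAt (fun u : E => innerSL ℝ (u - q)) ((innerSL ℝ).comp
        (ContinuousLinearMap.id ℝ E)) u :=
      (innerSL ℝ (E := E)).hasFDerivAt.comp u h0
    have h3 := h1.clm_apply h2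
    have h4 := (hasDerivAt_posPart_sq (‖u - q‖ ^ 2 - ρ ^ 2)).comp_hasFDerivAt u
      (h0.norm_sq.sub_const (ρ ^ 2))
    have h5 := (hasFDerivAt_id u).sub ((h4.smul h3).const_smul s)
    have h6 : fderiv ℝ F u = _ := HasFDerivAt.fderiv h5
    rw [h6]
    simp only [h, p, Y, Function.comp_apply, _root_.sub_apply, _root_.smul_apply, _root_.add_apply,
      ContinuousLinearMap.comp_apply, ContinuousLinearMap.coe_id', id_eq,
      ContinuousLinearMap.flip_apply, ContinuousLinearMap.smulRight_apply, innerSL_apply_apply,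
      smul_eq_mul, nsmul_eq_mul, Nat.cast_ofNat]
    congr 3
    rw [add_comm]
  have hest : ∀ u ∈ ball c r, ∀ v, G (F u) (fderiv ℝ F u v) (fderiv ℝ F u v) ≤
      G u v v - s * h u * ‖v‖ ^ 2 := fun u hu v => by
    obtain ⟨hGu, hHu, -, hfu, hinv⟩ := hbd u (hin u (hsub hu)).1
    have hsy := (hin u (hsub hu)).2
    rw [hder u hu v]
    have hi : ‖innerSL ℝ v‖ = ‖v‖ := innerSL_apply_norm ℝ v
    refine metric_contraction_estimate (ε := 2 * r) hL (by positivity) hrL hs0.le hs1 (hh0 u)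
      (hh1 u hu) (mul_nonneg zero_le_two (hm0 u)) ?_ hGu hsy ?_ (hYr u hu) ?_ ?_ ?_ ?_ ?_
    · linarith [hm u hu]
    · rw [← hmove]
      exact hlip u (hin u (hsub hu)).1 (F u) (hin _ (hmaps hu)).1
    · refine ((fderiv ℝ H u v).le_opNorm _).trans ?_
      rw [innerSL_apply_norm]
      gcongr
      · exact ((fderiv ℝ H u).le_opNorm _).trans (by gcongr)
      · exact hdist u hu
    · refine ((H u).le_opNorm _).trans ?_
      rw [innerSL_apply_norm]
      gcongr
    · rw [hsy, hinv, innerSL_apply_apply, real_inner_self_eq_norm_sq]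
    · rw [hsy, hinv, innerSL_apply_apply]
    · refine (abs_real_inner_le_norm _ _).trans ?_
      have := hdist u hu
      nlinarith [norm_nonneg v]
  refine ⟨F, fun u hu => (hcd u hu).contDiffWithinAt, hmaps, ?_, ?_, ?_⟩
  · intro u hu
    have : h u = 0 := by
      have : ‖u - q‖ ^ 2 ≤ ρ ^ 2 := by rw [← dist_eq_norm]; gcongr
      simp [h, this]
    simp [F, this]
  · intro u hu v
    have := hest u hu v
    have := mul_nonneg (mul_nonneg hs0.le (hh0 u)) (sq_nonneg ‖v‖)
    linarith
  · intro ρ' hρ'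
    -- A lower bound for `h` outside the `ρ'`-ball; the minimum with `1` keeps `1 - s * d / L`
    -- positive, so that its square root can serve as `k`.
    set d : ℝ := min 1 ((ρ' ^ 2 - ρ ^ 2) ^ 2) with hd
    have hd0 : 0 < d := by
      have : 0 < ρ' ^ 2 - ρ ^ 2 := by nlinarith
      positivity
    have hd1 : s * d / L < 1 := by
      rw [div_lt_one hL0]
      have : s * d ≤ s * 1 := by gcongr; exact min_le_left _ _
      nlinarith
    have hd2 : 0 < s * d / L := by positivity
    refine ⟨√(1 - s * d / L), Real.sqrt_nonneg _, ?_, ?_⟩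
    · rw [Real.sqrt_lt' one_pos]; linarith
    · intro u hu hu' v
      rw [Real.sq_sqrt (by linarith)]
      refine (hest u hu v).trans ?_
      have h1 : d ≤ h u := by
        refine (min_le_right _ _).trans ?_
        have : 0 < ρ' ^ 2 - ρ ^ 2 := by nlinarith
        have h2 : ρ' ^ 2 - ρ ^ 2 ≤ max 0 (‖u - q‖ ^ 2 - ρ ^ 2) := by
          refine le_trans ?_ (le_max_right _ _)
          rw [← dist_eq_norm]
          have : 0 ≤ ρ' := by linarith
          gcongr
        simp only [h]
        gcongr
      have h2 : G u v v ≤ L * ‖v‖ ^ 2 := by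
        have h3 := (G u).le_opNorm₂ v v
        rw [Real.norm_eq_abs] at h3
        refine (le_abs_self _).trans (h3.trans ?_)
        rw [mul_assoc, ← sq]
        gcongr
        exact (hbd u (hin u (hsub hu)).1).1
      have h3 : s * d / L * G u v v ≤ s * h u * ‖v‖ ^ 2 := by
        calc s * d / L * G u v v ≤ s * d / L * (L * ‖v‖ ^ 2) := by gcongr
          _ = s * d * ‖v‖ ^ 2 := by field_simp
          _ ≤ _ := by gcongr
      linarith

end CoreField

/-! ### The Riemannian metric and lengths of curves in a chart. -/

section Chart

set_option linter.unusedSectionVars false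

open Metric Manifold
open scoped Topology RealInnerProductSpace NNReal ENNReal

variable {E : Type*} [NormedAddCommGroup E] [InnerProductSpace ℝ E]
  {M : Type*} [TopologicalSpace M] [ChartedSpace E M] [IsManifold 𝓘(ℝ, E) ∞ M]
  [Bundle.RiemannianBundle (fun x : M => TangentSpace 𝓘(ℝ, E) x)]
  [IsContMDiffRiemannianBundle 𝓘(ℝ, E) ∞ E (fun x : M => TangentSpace 𝓘(ℝ, E) x)]

/-- The Riemannian metric in the chart at `p`, as a bilinear form at the points of the model
space. -/
def chartMetric (p : M) (u : E) : E →L[ℝ] E →L[ℝ] ℝ :=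
  (innerSL ℝ (E := TangentSpace 𝓘(ℝ, E) ((extChartAt 𝓘(ℝ, E) p).symm u))).bilinearComp
    ((trivializationAt E (TangentSpace 𝓘(ℝ, E)) p).symmL ℝ ((extChartAt 𝓘(ℝ, E) p).symm u))
    ((trivializationAt E (TangentSpace 𝓘(ℝ, E)) p).symmL ℝ ((extChartAt 𝓘(ℝ, E) p).symm u))

theorem chartMetric_apply (p : M) (u v w : E) :
    chartMetric p u v w =
      inner ℝ ((trivializationAt E (TangentSpace 𝓘(ℝ, E)) p).symmL ℝ
          ((extChartAt 𝓘(ℝ, E) p).symm u) v)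
        ((trivializationAt E (TangentSpace 𝓘(ℝ, E)) p).symmL ℝ
          ((extChartAt 𝓘(ℝ, E) p).symm u) w) := by
  rw [chartMetric, ContinuousLinearMap.bilinearComp_apply, innerSL_apply_apply]

theorem chartMetric_symm (p : M) (u v w : E) : chartMetric p u v w = chartMetric p u w v := by
  rw [chartMetric_apply, chartMetric_apply, real_inner_comm]

/-- Constant vectors of the model space become smooth local sections under the trivialization, and
the bundle metric is smooth on smooth sections. In finite dimension, smoothness of the bilinear form
may be tested on fixed vectors. -/
theorem contDiffOn_chartMetric [FiniteDimensional ℝ E] (p : M) :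
    ContDiffOn ℝ ∞ (chartMetric p) (extChartAt 𝓘(ℝ, E) p).target := by
  rw [contDiffOn_clm_apply]
  intro v
  rw [contDiffOn_clm_apply]
  intro w
  rw [← contMDiffOn_iff_contDiffOn]
  set e := trivializationAt E (TangentSpace 𝓘(ℝ, E)) p with he
  have hsec : ∀ v : E, ContMDiffOn 𝓘(ℝ, E) (𝓘(ℝ, E).prod 𝓘(ℝ, E)) ∞
      (fun x => (⟨x, e.symmL ℝ x v⟩ :
        Bundle.TotalSpace E (TangentSpace 𝓘(ℝ, E) : M → Type _))) e.baseSet := by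
    intro v
    rw [e.contMDiffOn_section_baseSet_iff]
    refine (contMDiffOn_const (c := v)).congr fun x hx => ?_
    rw [e.symmL_apply hx, e.apply_mk_symm hx]
  have hin : ContMDiffOn 𝓘(ℝ, E) 𝓘(ℝ, ℝ) ∞
      (fun x : M => inner ℝ (e.symmL ℝ x v) (e.symmL ℝ x w)) e.baseSet :=
    ContMDiffOn.inner_bundle (E := fun x : M => TangentSpace 𝓘(ℝ, E) x) (F := E) (hsec v)
      (hsec w)
  simp only [chartMetric_apply]
  refine hin.comp (contMDiffOn_extChartAt_symm p) fun u hu => ?_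
  have := (extChartAt 𝓘(ℝ, E) p).map_target hu
  simpa [he] using this

/-- The derivative of the chart at `p`, as a map to the model space. -/
def chartDeriv (p x : M) : TangentSpace 𝓘(ℝ, E) x →L[ℝ] E :=
  (trivializationAt E (TangentSpace 𝓘(ℝ, E)) p).continuousLinearMapAt ℝ x

/-- The length of a tangent vector in a chart. -/
theorem inner_eq_chartMetric {p x : M} (hx : x ∈ (chartAt E p).source)
    (ξ : TangentSpace 𝓘(ℝ, E) x) :
    inner ℝ ξ ξ = chartMetric p (extChartAt 𝓘(ℝ, E) p x) (chartDeriv p x ξ)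
      (chartDeriv p x ξ) := by
  rw [chartMetric_apply]
  have h : (extChartAt 𝓘(ℝ, E) p).symm (extChartAt 𝓘(ℝ, E) p x) = x :=
    (extChartAt 𝓘(ℝ, E) p).left_inv (by simpa using hx)
  rw [h]
  have hx' : x ∈ (trivializationAt E (TangentSpace 𝓘(ℝ, E)) p).baseSet := by simpa using hx
  have := (trivializationAt E (TangentSpace 𝓘(ℝ, E)) p).symmL_continuousLinearMapAt (R := ℝ) hx' ξ
  rw [chartDeriv, this]

/-- The derivative of a curve in a chart. -/
theorem derivWithin_extChartAt_comp {p : M} {γ : ℝ → M} {a b t : ℝ} (hab : a < b)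
    (ht : t ∈ Icc a b) (hγ : MDifferentiableWithinAt 𝓘(ℝ, ℝ) 𝓘(ℝ, E) γ (Icc a b) t)
    (hp : γ t ∈ (chartAt E p).source) :
    derivWithin (extChartAt 𝓘(ℝ, E) p ∘ γ) (Icc a b) t =
      chartDeriv p (γ t) (mfderivWithin 𝓘(ℝ, ℝ) 𝓘(ℝ, E) γ (Icc a b) t 1) := by
  have hu : UniqueMDiffWithinAt 𝓘(ℝ, ℝ) (Icc a b) t := by
    rw [uniqueMDiffWithinAt_iff_uniqueDiffWithinAt]
    exact uniqueDiffOn_Icc hab _ ht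
  have h1 := mfderiv_comp_mfderivWithin (I'' := 𝓘(ℝ, E)) t
    (mdifferentiableAt_extChartAt (I := 𝓘(ℝ, E)) hp) hγ hu
  rw [← fderivWithin_derivWithin, ← mfderivWithin_eq_fderivWithin, h1, chartDeriv,
    TangentBundle.continuousLinearMapAt_trivializationAt hp]
  rfl

/-- The speed of a curve in a chart. -/
theorem enorm_mfderivWithin_eq {p : M} {γ : ℝ → M} {a b t : ℝ} (hab : a < b)
    (ht : t ∈ Icc a b) (hγ : MDifferentiableWithinAt 𝓘(ℝ, ℝ) 𝓘(ℝ, E) γ (Icc a b) t)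
    (hp : γ t ∈ (chartAt E p).source) :
    ‖mfderivWithin 𝓘(ℝ, ℝ) 𝓘(ℝ, E) γ (Icc a b) t 1‖ₑ =
      ENNReal.ofReal √(chartMetric p (extChartAt 𝓘(ℝ, E) p (γ t))
        (derivWithin (extChartAt 𝓘(ℝ, E) p ∘ γ) (Icc a b) t)
        (derivWithin (extChartAt 𝓘(ℝ, E) p ∘ γ) (Icc a b) t)) := by
  rw [derivWithin_extChartAt_comp hab ht hγ hp, ← inner_eq_chartMetric hp,
    ← norm_eq_sqrt_real_inner, ofReal_norm]

theorem eventually_coercive_chartMetric (p : M) :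
    ∃ l : ℝ, 0 < l ∧ ∀ᶠ u in 𝓝 (extChartAt 𝓘(ℝ, E) p p), ∀ v,
      l * ‖v‖ ^ 2 ≤ chartMetric p u v v := by
  have : IsContinuousRiemannianBundle E (fun x : M => TangentSpace 𝓘(ℝ, E) x) := by
    obtain ⟨g, hg, hg'⟩ := IsContMDiffRiemannianBundle.exists_contMDiff (IB := 𝓘(ℝ, E)) (n := ∞)
      (F := E) (E := fun x : M => TangentSpace 𝓘(ℝ, E) x)
    exact ⟨g, hg.continuous, hg'⟩
  -- An upper bound for the trivialization as a map to the model space is a lower bound for the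
  -- metric.
  obtain ⟨C, hC, h⟩ := eventually_norm_trivializationAt_lt E
    (fun x : M => TangentSpace 𝓘(ℝ, E) x) p
  have h0 : (extChartAt 𝓘(ℝ, E) p).symm (extChartAt 𝓘(ℝ, E) p p) = p := by simp
  have h1 := (continuousAt_extChartAt_symm (I := 𝓘(ℝ, E)) p).eventually (by rw [h0]; exact h)
  refine ⟨(C ^ 2)⁻¹, by positivity, ?_⟩
  filter_upwards [h1, extChartAt_target_mem_nhds (I := 𝓘(ℝ, E)) p] with u hu hu' v
  rw [chartMetric_apply, real_inner_self_eq_norm_sq, inv_mul_le_iff₀ (by positivity), ← mul_pow]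
  have hb : (extChartAt 𝓘(ℝ, E) p).symm u ∈
      (trivializationAt E (TangentSpace 𝓘(ℝ, E)) p).baseSet := by
    have := (extChartAt 𝓘(ℝ, E) p).map_target hu'
    simpa using this
  have h2 := (trivializationAt E (TangentSpace 𝓘(ℝ, E)) p).continuousLinearMapAt_symmL
    (R := ℝ) hb v
  have h3 := ContinuousLinearMap.le_opNorm
    ((trivializationAt E (TangentSpace 𝓘(ℝ, E)) p).continuousLinearMapAt ℝ
      ((extChartAt 𝓘(ℝ, E) p).symm u)) ((trivializationAt E (TangentSpace 𝓘(ℝ, E)) p).symmL ℝ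
          ((extChartAt 𝓘(ℝ, E) p).symm u) v)
  rw [h2] at h3
  gcongr
  exact h3.trans (by gcongr)

/-- The speed of a curve `c` in the model space with respect to the metric in the chart at `p`. -/
def chartSpeed (p : M) (c : ℝ → E) (t : ℝ) : ℝ≥0∞ :=
  ENNReal.ofReal √(chartMetric p (c t) (derivWithin c (Icc 0 1) t) (derivWithin c (Icc 0 1) t))

theorem pathELength_eq_lintegral_chartSpeed {p : M} {γ : ℝ → M}
    (hγ : ContMDiffOn 𝓘(ℝ, ℝ) 𝓘(ℝ, E) 1 γ (Icc 0 1))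
    (hp : ∀ t ∈ Icc (0 : ℝ) 1, γ t ∈ (chartAt E p).source) :
    pathELength 𝓘(ℝ, E) γ 0 1 = ∫⁻ t in Icc 0 1, chartSpeed p (extChartAt 𝓘(ℝ, E) p ∘ γ) t := by
  rw [pathELength_eq_lintegral_mfderivWithin_Icc]
  refine setLIntegral_congr_fun measurableSet_Icc fun t ht => ?_
  exact enorm_mfderivWithin_eq one_pos ht (hγ.mdifferentiableOn one_ne_zero t ht) (hp t ht)

theorem contDiffOn_extChartAt_comp {p : M} {γ : ℝ → M}
    (hγ : ContMDiffOn 𝓘(ℝ, ℝ) 𝓘(ℝ, E) 1 γ (Icc 0 1))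
    (hp : ∀ t ∈ Icc (0 : ℝ) 1, γ t ∈ (chartAt E p).source) :
    ContDiffOn ℝ 1 (extChartAt 𝓘(ℝ, E) p ∘ γ) (Icc 0 1) := by
  rw [← contMDiffOn_iff_contDiffOn]
  exact (contMDiffOn_extChartAt (I := 𝓘(ℝ, E)) (n := 1)).comp hγ hp

/-- The distance of two points is at most the length of a curve in the chart. -/
theorem riemannianEDist_le_lintegral_chartSpeed {p : M} {c : ℝ → E}
    (hc : ContDiffOn ℝ 1 c (Icc 0 1))
    (hp : ∀ t ∈ Icc (0 : ℝ) 1, c t ∈ (extChartAt 𝓘(ℝ, E) p).target) :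
    riemannianEDist 𝓘(ℝ, E) ((extChartAt 𝓘(ℝ, E) p).symm (c 0))
      ((extChartAt 𝓘(ℝ, E) p).symm (c 1)) ≤ ∫⁻ t in Icc 0 1, chartSpeed p c t := by
  set γ : ℝ → M := (extChartAt 𝓘(ℝ, E) p).symm ∘ c with hγ
  have h1 : ContMDiffOn 𝓘(ℝ, ℝ) 𝓘(ℝ, E) 1 γ (Icc 0 1) :=
    (contMDiffOn_extChartAt_symm (n := 1) p).comp (contMDiffOn_iff_contDiffOn.2 hc) hp
  have h2 : ∀ t ∈ Icc (0 : ℝ) 1, γ t ∈ (chartAt E p).source := fun t ht => by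
    have := (extChartAt 𝓘(ℝ, E) p).map_target (hp t ht)
    rwa [extChartAt_source] at this
  have h3 : EqOn (extChartAt 𝓘(ℝ, E) p ∘ γ) c (Icc 0 1) := fun t ht =>
    (extChartAt 𝓘(ℝ, E) p).right_inv (hp t ht)
  refine (riemannianEDist_le_pathELength h1 rfl rfl zero_le_one).trans_eq ?_
  rw [pathELength_eq_lintegral_chartSpeed h1 h2]
  refine setLIntegral_congr_fun measurableSet_Icc fun t ht => ?_
  simp only [chartSpeed]
  rw [h3 ht, derivWithin_congr h3 (h3 ht)]

/-- A map of the model space that contracts the metric of the chart contracts lengths. -/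
theorem riemannianEDist_map_le {p : M} {U V : Set E} {F : E → E} {k : ℝ} (hV : IsOpen V)
    (hF : ContDiffOn ℝ 1 F V) (hFV : MapsTo F V (extChartAt 𝓘(ℝ, E) p).target) (hUV : U ⊆ V)
    (hk : 0 ≤ k) (hU : ∀ u ∈ U, ∀ v, chartMetric p (F u) (fderiv ℝ F u v) (fderiv ℝ F u v) ≤
      k ^ 2 * chartMetric p u v v) {γ : ℝ → M}
    (hγ : ContMDiffOn 𝓘(ℝ, ℝ) 𝓘(ℝ, E) 1 γ (Icc 0 1))
    (hp : ∀ t ∈ Icc (0 : ℝ) 1, γ t ∈ (chartAt E p).source ∧ extChartAt 𝓘(ℝ, E) p (γ t) ∈ U) :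
    riemannianEDist 𝓘(ℝ, E) ((extChartAt 𝓘(ℝ, E) p).symm (F (extChartAt 𝓘(ℝ, E) p (γ 0))))
      ((extChartAt 𝓘(ℝ, E) p).symm (F (extChartAt 𝓘(ℝ, E) p (γ 1)))) ≤
      ENNReal.ofReal k * pathELength 𝓘(ℝ, E) γ 0 1 := by
  set c := extChartAt 𝓘(ℝ, E) p ∘ γ with hc
  have hc1 : ContDiffOn ℝ 1 c (Icc 0 1) := contDiffOn_extChartAt_comp hγ fun t ht => (hp t ht).1
  have hFc : ContDiffOn ℝ 1 (F ∘ c) (Icc 0 1) := hF.comp hc1 fun t ht => hUV (hp t ht).2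
  refine (riemannianEDist_le_lintegral_chartSpeed hFc
    fun t ht => hFV (hUV (hp t ht).2)).trans ?_
  rw [pathELength_eq_lintegral_chartSpeed hγ fun t ht => (hp t ht).1,
    ← lintegral_const_mul' _ _ ENNReal.ofReal_ne_top]
  refine setLIntegral_mono' measurableSet_Icc fun t ht => ?_
  have hd : derivWithin (F ∘ c) (Icc 0 1) t = fderiv ℝ F (c t) (derivWithin c (Icc 0 1) t) := by
    have h1 : HasFDerivAt F (fderiv ℝ F (c t)) (c t) :=
      ((hF.contDiffAt (hV.mem_nhds (hUV (hp t ht).2))).differentiableAt one_ne_zero).hasFDerivAt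
    exact (h1.comp_hasDerivWithinAt t
      (hc1.differentiableOn one_ne_zero t ht).hasDerivWithinAt).derivWithin
      (uniqueDiffOn_Icc one_pos t ht)
  rw [chartSpeed, chartSpeed, hd, ← ENNReal.ofReal_mul hk]
  refine ENNReal.ofReal_le_ofReal ((Real.sqrt_le_sqrt (hU _ (hp t ht).2 _)).trans_eq ?_)
  rw [Real.sqrt_mul (sq_nonneg k), Real.sqrt_sq hk]
  rfl

/-- The chart is Lipschitz along paths where the metric is bounded below. -/
theorem edist_extChartAt_le {p : M} {U : Set E} {l : ℝ} (hl : 0 < l)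
    (hU : ∀ u ∈ U, ∀ v, l ^ 2 * ‖v‖ ^ 2 ≤ chartMetric p u v v) {γ : ℝ → M}
    (hγ : ContMDiffOn 𝓘(ℝ, ℝ) 𝓘(ℝ, E) 1 γ (Icc 0 1))
    (hp : ∀ t ∈ Icc (0 : ℝ) 1, γ t ∈ (chartAt E p).source ∧ extChartAt 𝓘(ℝ, E) p (γ t) ∈ U) :
    edist (extChartAt 𝓘(ℝ, E) p (γ 0)) (extChartAt 𝓘(ℝ, E) p (γ 1)) ≤
      ENNReal.ofReal l⁻¹ * pathELength 𝓘(ℝ, E) γ 0 1 := by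
  set c := extChartAt 𝓘(ℝ, E) p ∘ γ with hc
  have hc1 : ContDiffOn ℝ 1 c (Icc 0 1) := contDiffOn_extChartAt_comp hγ fun t ht => (hp t ht).1
  rw [edist_comm, edist_eq_enorm_sub]
  refine (enorm_sub_le_lintegral_derivWithin_Icc_of_contDiffOn_Icc hc1 zero_le_one).trans ?_
  rw [pathELength_eq_lintegral_chartSpeed hγ fun t ht => (hp t ht).1,
    ← lintegral_const_mul' _ _ ENNReal.ofReal_ne_top]
  refine setLIntegral_mono' measurableSet_Icc fun t ht => ?_
  rw [chartSpeed, ← ENNReal.ofReal_mul (by positivity), ← ofReal_norm]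
  refine ENNReal.ofReal_le_ofReal ?_
  rw [le_inv_mul_iff₀ hl]
  refine Real.le_sqrt_of_sq_le ?_
  rw [mul_pow]
  exact hU _ (hp t ht).2 _

/-- The inverse chart is Lipschitz on convex sets where the metric is bounded above. -/
theorem riemannianEDist_extChartAt_symm_le {p : M} {U : Set E} {K : ℝ} (hK : 0 ≤ K)
    (hUc : Convex ℝ U) (hUt : U ⊆ (extChartAt 𝓘(ℝ, E) p).target)
    (hU : ∀ u ∈ U, ∀ v, chartMetric p u v v ≤ K ^ 2 * ‖v‖ ^ 2) {u w : E} (hu : u ∈ U)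
    (hw : w ∈ U) :
    riemannianEDist 𝓘(ℝ, E) ((extChartAt 𝓘(ℝ, E) p).symm u) ((extChartAt 𝓘(ℝ, E) p).symm w) ≤
      ENNReal.ofReal K * edist u w := by
  set c : ℝ → E := fun t => u + t • (w - u) with hc
  have hcU : ∀ t ∈ Icc (0 : ℝ) 1, c t ∈ U := fun t ht => hUc.add_smul_sub_mem hu hw ht
  have h0 : c 0 = u := by simp [hc]
  have h1 : c 1 = w := by simp [hc]
  have hd : ∀ t ∈ Icc (0 : ℝ) 1, derivWithin c (Icc 0 1) t = w - u := fun t ht => by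
    have : HasDerivAt c (w - u) t := by
      have := ((hasDerivAt_id t).smul_const (w - u)).const_add u
      rwa [one_smul] at this
    exact this.hasDerivWithinAt.derivWithin (uniqueDiffOn_Icc one_pos t ht)
  have := riemannianEDist_le_lintegral_chartSpeed (p := p) (c := c)
    (by fun_prop) fun t ht => hUt (hcU t ht)
  rw [h0, h1] at this
  refine this.trans ?_
  have h2 : ∫⁻ _ in Icc (0 : ℝ) 1, ENNReal.ofReal K * edist u w = ENNReal.ofReal K * edist u w := by
    simp
  rw [← h2]
  refine setLIntegral_mono' measurableSet_Icc fun t ht => ?_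
  rw [chartSpeed, hd t ht, edist_comm, edist_eq_enorm_sub, ← ofReal_norm, ← ENNReal.ofReal_mul hK]
  refine ENNReal.ofReal_le_ofReal (Real.sqrt_le_iff.2 ⟨by positivity, ?_⟩)
  rw [mul_pow]
  exact hU _ (hcU t ht) _

end Chart

/-! ### From lengths of paths to distances. -/

section RiemannianDist
open Metric Manifold
open scoped Topology RealInnerProductSpace NNReal ENNReal

set_option linter.unusedSectionVars false

variable {E : Type*} [NormedAddCommGroup E] [InnerProductSpace ℝ E]
  {M : Type*} [MetricSpace M] [ChartedSpace E M] [IsManifold 𝓘(ℝ, E) ∞ M]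
  [Bundle.RiemannianBundle (fun x : M => TangentSpace 𝓘(ℝ, E) x)]
  [IsContMDiffRiemannianBundle 𝓘(ℝ, E) ∞ E (fun x : M => TangentSpace 𝓘(ℝ, E) x)]
  [IsRiemannianManifold 𝓘(ℝ, E) M]

variable (E) in
/-- Almost minimizing paths stay close to their starting point. -/
theorem exists_path_pathELength_lt (x y : M) {η : ℝ} (h : dist x y < η) :
    ∃ γ : ℝ → M, γ 0 = x ∧ γ 1 = y ∧ ContMDiffOn 𝓘(ℝ, ℝ) 𝓘(ℝ, E) 1 γ (Icc 0 1) ∧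
      pathELength 𝓘(ℝ, E) γ 0 1 < ENNReal.ofReal η ∧ ∀ t ∈ Icc (0 : ℝ) 1, γ t ∈ ball x η ∧
        edist x (γ t) + edist (γ t) y < ENNReal.ofReal η := by
  have h1 : riemannianEDist 𝓘(ℝ, E) x y < ENNReal.ofReal η := by
    rw [← IsRiemannianManifold.out, edist_dist]
    exact (ENNReal.ofReal_lt_ofReal_iff (dist_nonneg.trans_lt h)).2 h
  obtain ⟨γ, h0, h1, hγ, hlen⟩ := exists_lt_of_riemannianEDist_lt h1
  -- Cutting the path at `t` and adding the lengths of the two pieces bounds the sum of the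
  -- distances.
  have key : ∀ t ∈ Icc (0 : ℝ) 1, edist x (γ t) + edist (γ t) y < ENNReal.ofReal η := by
    intro t ht
    refine lt_of_le_of_lt ?_ hlen
    rw [← pathELength_add ht.1 ht.2, IsRiemannianManifold.out (I := 𝓘(ℝ, E)) x,
      IsRiemannianManifold.out (I := 𝓘(ℝ, E)) _ y]
    exact add_le_add
      (riemannianEDist_le_pathELength (hγ.mono (Icc_subset_Icc le_rfl ht.2)) h0 rfl ht.1)
      (riemannianEDist_le_pathELength (hγ.mono (Icc_subset_Icc ht.1 le_rfl)) rfl h1 ht.2)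
  refine ⟨γ, h0, h1, hγ, hlen, fun t ht => ⟨?_, key t ht⟩⟩
  have := (le_self_add).trans_lt (key t ht)
  rw [edist_dist] at this
  rw [mem_ball']
  exact (ENNReal.ofReal_lt_ofReal_iff (dist_nonneg.trans_lt h)).1 this

/-- In a Riemannian manifold there are points that lie almost between two given points, at any
intermediate distance. -/
theorem exists_dist_add_dist_le (E : Type*) [NormedAddCommGroup E] [InnerProductSpace ℝ E]
    {M : Type*} [MetricSpace M] [ChartedSpace E M] [IsManifold 𝓘(ℝ, E) ∞ M]
    [Bundle.RiemannianBundle (fun x : M => TangentSpace 𝓘(ℝ, E) x)]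
    [IsContMDiffRiemannianBundle 𝓘(ℝ, E) ∞ E (fun x : M => TangentSpace 𝓘(ℝ, E) x)]
    [IsRiemannianManifold 𝓘(ℝ, E) M] (x z : M) {s ε : ℝ} (hs0 : 0 ≤ s) (hs : s ≤ dist x z)
    (hε : 0 < ε) :
    ∃ w, dist w z = s ∧ dist x w + dist w z ≤ dist x z + ε := by
  obtain ⟨γ, h0, h1, hγ, -, hb⟩ := exists_path_pathELength_lt E x z (lt_add_of_pos_right _ hε)
  have hγc : ContinuousOn γ (Icc 0 1) := hγ.continuousOn
  have hc : ContinuousOn (fun t => dist (γ t) z) (Icc 0 1) :=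
    (continuous_id.dist continuous_const).comp_continuousOn hγc
  obtain ⟨t, ht, hts⟩ := intermediate_value_Icc' zero_le_one hc
    (show s ∈ Icc (dist (γ 1) z) (dist (γ 0) z) by rw [h0, h1, dist_self]; exact ⟨hs0, hs⟩)
  refine ⟨γ t, hts, ?_⟩
  have := (hb t ht).2
  rw [edist_dist, edist_dist, ← ENNReal.ofReal_add dist_nonneg dist_nonneg] at this
  exact ((ENNReal.ofReal_lt_ofReal_iff (by positivity)).1 this).le

/-- Lets the excess length of almost minimizing paths tend to zero. The bound `d + ε ≤ R` confines
these paths to the ball where the chart estimates hold. -/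
theorem le_mul_of_forall_add {a k d R : ℝ} (hd : d < R)
    (h : ∀ ε, 0 < ε → d + ε ≤ R → a ≤ k * (d + ε)) : a ≤ k * d := by
  have h1 : Filter.Tendsto (fun ε => k * (d + ε)) (𝓝[>] 0) (𝓝 (k * d)) := by
    have : ContinuousAt (fun ε => k * (d + ε)) 0 := by fun_prop
    have := this.tendsto
    rw [add_zero] at this
    exact this.mono_left nhdsWithin_le_nhds
  refine ge_of_tendsto h1 ?_
  have : ∀ᶠ ε in 𝓝[>] (0 : ℝ), ε < R - d :=
    nhdsWithin_le_nhds (gt_mem_nhds (by linarith))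
  filter_upwards [this, self_mem_nhdsWithin] with ε hε hε0
  exact h ε hε0 (by linarith)

/-- A map that contracts the metric of a chart contracts the distance. -/
theorem dist_map_le {p : M} {U V : Set E} {F : E → E} {k R : ℝ} (hV : IsOpen V)
    (hF : ContDiffOn ℝ 1 F V) (hFV : MapsTo F V (extChartAt 𝓘(ℝ, E) p).target) (hUV : U ⊆ V)
    (hk : 0 ≤ k) (hU : ∀ u ∈ U, ∀ v, chartMetric p (F u) (fderiv ℝ F u v) (fderiv ℝ F u v) ≤
      k ^ 2 * chartMetric p u v v) {x y : M} (hxy : dist x y < R)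
    (hp : ∀ w ∈ ball x R, w ∈ (chartAt E p).source ∧ extChartAt 𝓘(ℝ, E) p w ∈ U) :
    dist ((extChartAt 𝓘(ℝ, E) p).symm (F (extChartAt 𝓘(ℝ, E) p x)))
      ((extChartAt 𝓘(ℝ, E) p).symm (F (extChartAt 𝓘(ℝ, E) p y))) ≤ k * dist x y := by
  refine le_mul_of_forall_add hxy fun ε hε hR => ?_
  obtain ⟨γ, h0, h1, hγ, hlen, hb⟩ := exists_path_pathELength_lt E x y (lt_add_of_pos_right _ hε)
  have := riemannianEDist_map_le hV hF hFV hUV hk hU hγ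
    fun t ht => hp _ (ball_subset_ball hR (hb t ht).1)
  rw [← IsRiemannianManifold.out, h0, h1, edist_dist] at this
  have h2 := this.trans (mul_le_mul_right hlen.le _)
  rw [← ENNReal.ofReal_mul hk] at h2
  exact (ENNReal.ofReal_le_ofReal_iff (by positivity)).1 h2

/-- Almost minimizing paths stay in `ball x R`, hence where the lower bound for the metric is
available; the estimate along paths then passes to the infimum. -/
theorem dist_extChartAt_le {p : M} {U : Set E} {l R : ℝ} (hl : 0 < l)
    (hU : ∀ u ∈ U, ∀ v, l ^ 2 * ‖v‖ ^ 2 ≤ chartMetric p u v v) {x y : M} (hxy : dist x y < R)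
    (hp : ∀ w ∈ ball x R, w ∈ (chartAt E p).source ∧ extChartAt 𝓘(ℝ, E) p w ∈ U) :
    dist (extChartAt 𝓘(ℝ, E) p x) (extChartAt 𝓘(ℝ, E) p y) ≤ l⁻¹ * dist x y := by
  refine le_mul_of_forall_add hxy fun ε hε hR => ?_
  obtain ⟨γ, h0, h1, hγ, hlen, hb⟩ := exists_path_pathELength_lt E x y (lt_add_of_pos_right _ hε)
  have := edist_extChartAt_le hl hU hγ fun t ht => hp _ (ball_subset_ball hR (hb t ht).1)
  rw [h0, h1, edist_dist] at this
  have h2 := this.trans (mul_le_mul_right hlen.le _)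
  rw [← ENNReal.ofReal_mul (by positivity)] at h2
  exact (ENNReal.ofReal_le_ofReal_iff (by positivity)).1 h2

/-- One competitor suffices in this direction, the straight segment, so convexity of `U` replaces
control over paths. -/
theorem dist_extChartAt_symm_le {p : M} {U : Set E} {K : ℝ} (hK : 0 ≤ K)
    (hUc : Convex ℝ U) (hUt : U ⊆ (extChartAt 𝓘(ℝ, E) p).target)
    (hU : ∀ u ∈ U, ∀ v, chartMetric p u v v ≤ K ^ 2 * ‖v‖ ^ 2) {u w : E} (hu : u ∈ U)
    (hw : w ∈ U) :
    dist ((extChartAt 𝓘(ℝ, E) p).symm u) ((extChartAt 𝓘(ℝ, E) p).symm w) ≤ K * dist u w := by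
  have := riemannianEDist_extChartAt_symm_le hK hUc hUt hU hu hw
  rw [← IsRiemannianManifold.out, edist_dist, edist_dist, ← ENNReal.ofReal_mul hK] at this
  exact (ENNReal.ofReal_le_ofReal_iff (by positivity)).1 this

set_option maxSynthPendingDepth 3 in
/-- Near a point, the chart is defined and the metric is equivalent to the Euclidean one. -/
theorem exists_chart_bounds [FiniteDimensional ℝ E] (p : M) :
    ∃ r₀ L : ℝ, 0 < r₀ ∧ 1 ≤ L ∧
      ball (extChartAt 𝓘(ℝ, E) p p) r₀ ⊆ (extChartAt 𝓘(ℝ, E) p).target ∧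
      ∀ u ∈ ball (extChartAt 𝓘(ℝ, E) p p) r₀, ∀ v,
        L⁻¹ ^ 2 * ‖v‖ ^ 2 ≤ chartMetric p u v v ∧ chartMetric p u v v ≤ L ^ 2 * ‖v‖ ^ 2 := by
  obtain ⟨l, hl, hco⟩ := eventually_coercive_chartMetric (E := E) p
  have htn := extChartAt_target_mem_nhds (I := 𝓘(ℝ, E)) p
  set c := extChartAt 𝓘(ℝ, E) p p
  have hG : ContDiffAt ℝ ∞ (chartMetric (E := E) p) c := (contDiffOn_chartMetric p).contDiffAt htn
  have hGb : ∀ᶠ u in 𝓝 c, ‖chartMetric (E := E) p u‖ < ‖chartMetric (E := E) p c‖ + 1 := by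
    have : Filter.Tendsto (fun u => ‖chartMetric (E := E) p u‖) (𝓝 c)
      (𝓝 ‖chartMetric (E := E) p c‖) := hG.continuousAt.norm
    exact this.eventually (gt_mem_nhds (lt_add_one _))
  obtain ⟨r₀, hr₀, hb⟩ := Metric.mem_nhds_iff.1 (Filter.inter_mem htn (hco.and hGb))
  set L : ℝ := max 1 (max (l⁻¹) (‖chartMetric (E := E) p c‖ + 1))
  have hL1 : 1 ≤ L := le_max_left _ _
  have hLL : L ≤ L ^ 2 := le_self_pow₀ hL1 two_ne_zero
  refine ⟨r₀, L, hr₀, hL1, fun u hu => (hb hu).1, fun u hu v => ⟨?_, ?_⟩⟩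
  · refine le_trans ?_ ((hb hu).2.1 v)
    gcongr
    rw [inv_pow]
    refine inv_le_of_inv_le₀ hl (le_trans ?_ hLL)
    exact (le_max_left _ _).trans (le_max_right _ _)
  · have h3 := (chartMetric p u).le_opNorm₂ v v
    rw [Real.norm_eq_abs] at h3
    refine (le_abs_self _).trans (h3.trans ?_)
    rw [mul_assoc, ← sq]
    gcongr
    exact (hb hu).2.2.le.trans (((le_max_right _ _).trans (le_max_right _ _)).trans hLL)

/-- Metric balls are small in the chart. -/
theorem exists_ball_subset_chart (p : M) {r : ℝ} (hr : 0 < r) : ∃ δ > 0, ∀ w ∈ ball p δ,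
    w ∈ (chartAt E p).source ∧ extChartAt 𝓘(ℝ, E) p w ∈ ball (extChartAt 𝓘(ℝ, E) p p) r := by
  have h1 := extChartAt_source_mem_nhds (I := 𝓘(ℝ, E)) p
  have h2 := (continuousAt_extChartAt (I := 𝓘(ℝ, E)) p).preimage_mem_nhds (ball_mem_nhds _ hr)
  obtain ⟨δ, hδ, hb⟩ := Metric.mem_nhds_iff.1 (Filter.inter_mem h1 h2)
  refine ⟨δ, hδ, fun w hw => ⟨?_, (hb hw).2⟩⟩
  have := (hb hw).1
  rwa [extChartAt_source] at this

end RiemannianDist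

section LocalGeometry
open Metric Manifold
open scoped Topology RealInnerProductSpace NNReal ENNReal

set_option linter.unusedSectionVars false

/-! ### Convexity of small chart balls and local size of hulls. -/

section Hull

variable {E : Type*} [NormedAddCommGroup E] [InnerProductSpace ℝ E] [FiniteDimensional ℝ E]
  {M : Type*} [MetricSpace M] [ChartedSpace E M] [IsManifold 𝓘(ℝ, E) ∞ M]
  [Bundle.RiemannianBundle (fun x : M => TangentSpace 𝓘(ℝ, E) x)]
  [IsContMDiffRiemannianBundle 𝓘(ℝ, E) ∞ E (fun x : M => TangentSpace 𝓘(ℝ, E) x)]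
  [IsRiemannianManifold 𝓘(ℝ, E) M]

/-- A small Euclidean ball in a chart is geodesically convex. -/
theorem geodesicallyConvex_chart_ball (p : M) :
    ∃ r₁ > 0, ∀ r, 0 < r → r ≤ r₁ → ∀ R, (∀ w ∈ ball p R, w ∈ (chartAt E p).source ∧
        extChartAt 𝓘(ℝ, E) p w ∈ ball (extChartAt 𝓘(ℝ, E) p p) r) →
      ∀ q ∈ ball p R, ∀ ρ > 0,
        (∀ x ∈ ball p R, dist (extChartAt 𝓘(ℝ, E) p x) (extChartAt 𝓘(ℝ, E) p q) ≤ ρ →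
          dist p x < R / 8) →
        GeodesicallyConvex
          {x | x ∈ ball p R ∧ dist (extChartAt 𝓘(ℝ, E) p x) (extChartAt 𝓘(ℝ, E) p q) ≤ ρ} := by
  have htn := extChartAt_target_mem_nhds (I := 𝓘(ℝ, E)) p
  obtain ⟨r₁, hr₁, hcontr⟩ := exists_contraction
    (((contDiffOn_chartMetric (E := E) p).contDiffAt htn).of_le (by norm_cast))
    (Filter.Eventually.of_forall fun u v w => chartMetric_symm p u v w)
    (eventually_coercive_chartMetric p)
  obtain ⟨r₂, hr₂, htb⟩ := Metric.mem_nhds_iff.1 htn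
  refine ⟨min r₁ (r₂ / 2), by positivity, ?_⟩
  intro r hr hrr R hR q hq ρ hρ hsmall x hx y hy z hz
  set φ := extChartAt 𝓘(ℝ, E) p with hφ
  obtain ⟨hxR, hxρ⟩ := hx
  obtain ⟨hyR, hyρ⟩ := hy
  have hR0 : 0 < R := pos_of_mem_ball hxR
  have hpx := hsmall x hxR hxρ
  have hpy := hsmall y hyR hyρ
  have hxy : dist x y < R / 4 := by
    have := dist_triangle_left x y p
    linarith
  have hxz : dist x z < R / 4 := by linarith [dist_nonneg (x := z) (y := y)]
  have hzy : dist z y < R / 4 := by linarith [dist_nonneg (x := x) (y := z)]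
  have hpz : dist p z < 3 * R / 8 := by
    have := dist_triangle p x z
    linarith
  have hzR : z ∈ ball p R := by rw [mem_ball']; linarith
  refine ⟨hzR, ?_⟩
  by_contra! hcon
  obtain ⟨F, hF, hmaps, hfix, h1, hstrict⟩ := hcontr r hr (hrr.trans (min_le_left _ _)) (φ q)
    (hR q hq).2 ρ hρ
  have hFt : MapsTo F (ball (φ p) r) φ.target := fun u hu =>
    htb (ball_subset_ball (by linarith [hrr.trans (min_le_right _ _)]) (hmaps hu))
  -- A radius strictly between `ρ` and that of `z`: a whole neighbourhood of `z` then lies in the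
  -- region of strict contraction.
  set ρ' : ℝ := (ρ + dist (φ z) (φ q)) / 2 with hρ'
  obtain ⟨k, hk0, hk1, hk⟩ := hstrict ρ' (by simp only [hρ', gt_iff_lt]; linarith)
  -- All points used below are within `3 * R / 4` of `p`, so paths of length below `R / 4` starting
  -- there do not leave `ball p R`.
  have hball : ∀ a, dist p a < 3 * R / 4 → ∀ w ∈ ball a (R / 4),
      w ∈ (chartAt E p).source ∧ φ w ∈ ball (φ p) r := fun a ha w hw => by
    refine hR w ?_
    rw [mem_ball'] at hw ⊢
    linarith [dist_triangle p a w]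
  have hΦ : ∀ a ∈ ball p R, dist (φ a) (φ q) ≤ ρ → φ.symm (F (φ a)) = a := fun a ha hρa => by
    rw [hfix _ hρa]
    refine φ.left_inv ?_
    rw [hφ, extChartAt_source]
    exact (hR a ha).1
  have hlip : ∀ a b, dist p a < 3 * R / 4 → dist a b < R / 4 →
      dist (φ.symm (F (φ a))) (φ.symm (F (φ b))) ≤ dist a b := fun a b ha hab => by
    have := dist_map_le isOpen_ball hF hFt subset_rfl zero_le_one
      (fun u hu v => by rw [one_pow, one_mul]; exact h1 u hu v) hab (hball a ha)
    rwa [one_mul] at this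
  have hzy' := hlip z y (by linarith) hzy
  rw [hΦ y hyR hyρ] at hzy'
  -- near `z` the map is strictly contracting
  obtain ⟨e, he, heb⟩ : ∃ e > 0, ∀ w ∈ ball z e, ρ' < dist (φ w) (φ q) := by
    have hcont : ContinuousAt (fun w => dist (φ w) (φ q)) z := by
      have : ContinuousAt φ z := continuousAt_extChartAt' (by
        rw [extChartAt_source]; exact (hR z hzR).1)
      exact (continuous_id.dist continuous_const).continuousAt.comp this
    have hev : ∀ᶠ w in 𝓝 z, ρ' < dist (φ w) (φ q) :=
      hcont.eventually (lt_mem_nhds (by simp only [hρ']; linarith))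
    exact Metric.mem_nhds_iff.1 hev
  have hxe : e ≤ dist x z := by
    by_contra! hlt
    have := heb x hlt
    simp only [hρ'] at this
    linarith
  -- Strict contraction holds only near `z`, so it is used on the last stretch from `w` to `z`. It
  -- gains `(1 - k) * e / 4`, twice the permitted defect of betweenness.
  obtain ⟨w, hwz, hw⟩ := exists_dist_add_dist_le E x z (s := e / 4) (ε := (1 - k) * e / 8)
    (by positivity) (by linarith) (by have : 0 < 1 - k := by linarith
                                      positivity)
  have hxw : dist x w < R / 4 := by nlinarith
  have hpw : dist p w < 3 * R / 4 := by linarith [dist_triangle p x w]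
  have hxw' := hlip x w (by linarith) hxw
  rw [hΦ x hxR hxρ] at hxw'
  have hwz' : dist (φ.symm (F (φ w))) (φ.symm (F (φ z))) ≤ k * dist w z := by
    refine dist_map_le (U := {u | u ∈ ball (φ p) r ∧ ρ' ≤ dist u (φ q)}) (R := e / 2) isOpen_ball
      hF hFt (fun u hu => hu.1) hk0 (fun u hu v => hk u hu.1 hu.2 v) (by rw [hwz]; linarith) ?_
    intro a ha
    rw [mem_ball] at ha
    have h2 := hball w hpw a (by rw [mem_ball]; linarith)
    refine ⟨h2.1, h2.2, (heb a ?_).le⟩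
    rw [mem_ball]
    linarith [dist_triangle a w z]
  -- `F` fixes `x` and `y`, so this chain joins them and is shorter than `dist x z + dist z y = dist
  -- x y`.
  have := dist_triangle4 x (φ.symm (F (φ w))) (φ.symm (F (φ z))) y
  rw [hwz] at hwz' hw
  nlinarith

/-- Geodesic hulls of small balls have comparable radius, locally uniformly. -/
theorem exists_geodesicHull_closedBall_subset (E : Type*) [NormedAddCommGroup E]
    [InnerProductSpace ℝ E] [FiniteDimensional ℝ E] {M : Type*} [MetricSpace M] [ChartedSpace E M]
    [IsManifold 𝓘(ℝ, E) ∞ M] [Bundle.RiemannianBundle (fun x : M => TangentSpace 𝓘(ℝ, E) x)]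
    [IsContMDiffRiemannianBundle 𝓘(ℝ, E) ∞ E (fun x : M => TangentSpace 𝓘(ℝ, E) x)]
    [IsRiemannianManifold 𝓘(ℝ, E) M] (p : M) :
    ∃ δ > 0, ∃ C > 0, ∀ q ∈ ball p δ, ∀ d, 0 < d → d < δ →
      geodesicHull (closedBall q d) ⊆ closedBall q (C * d) := by
  obtain ⟨r₀, L, hr₀, hL, htarget, hbd⟩ := exists_chart_bounds (E := E) p
  obtain ⟨r₁, hr₁, hconv⟩ := geodesicallyConvex_chart_ball (E := E) p
  obtain ⟨R, hR0, hR⟩ := exists_ball_subset_chart (E := E) p (r := min r₀ r₁) (by positivity)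
  have hL0 : 0 < L := by linarith
  have hL2 : 1 ≤ L ^ 2 := one_le_pow₀ hL
  set φ := extChartAt 𝓘(ℝ, E) p with hφ
  have hlow : ∀ u ∈ ball (φ p) (min r₀ r₁), ∀ v, L⁻¹ ^ 2 * ‖v‖ ^ 2 ≤ chartMetric p u v v :=
    fun u hu v => (hbd u (ball_subset_ball (min_le_left _ _) hu) v).1
  have hup : ∀ u ∈ ball (φ p) (min r₀ r₁), ∀ v, chartMetric p u v v ≤ L ^ 2 * ‖v‖ ^ 2 :=
    fun u hu v => (hbd u (ball_subset_ball (min_le_left _ _) hu) v).2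
  -- The metric ball of radius `d` lies in the chart ball of radius `L * d`, whose points are within
  -- `L ^ 2 * d` of `q`. The `32` places this chart ball within `R / 8` of `p`, as its convexity
  -- requires.
  refine ⟨R / (32 * L ^ 2), by positivity, L ^ 2, by positivity, ?_⟩
  intro q hq d hd hdδ
  rw [mem_ball', lt_div_iff₀ (by positivity)] at hq
  rw [lt_div_iff₀ (by positivity)] at hdδ
  have hq' : dist p q < R / 32 := by nlinarith [dist_nonneg (x := p) (y := q)]
  have hd' : d < R / 32 := by nlinarith
  have hqR : q ∈ ball p R := by rw [mem_ball']; linarith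
  have hclose : ∀ x ∈ ball p R, dist (φ x) (φ q) ≤ L * d → dist x q ≤ L ^ 2 * d := by
    intro x hx hxq
    have := dist_extChartAt_symm_le hL0.le (convex_ball (φ p) (min r₀ r₁))
      ((ball_subset_ball (min_le_left _ _)).trans htarget) hup (hR x hx).2 (hR q hqR).2
    rw [φ.left_inv (by rw [hφ, extChartAt_source]; exact (hR x hx).1),
      φ.left_inv (by rw [hφ, extChartAt_source]; exact (hR q hqR).1)] at this
    refine this.trans ?_
    calc L * dist (φ x) (φ q) ≤ L * (L * d) := by gcongr
      _ = L ^ 2 * d := by ring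
  have hK := hconv (min r₀ r₁) (by positivity) (min_le_right _ _) R hR q hqR (L * d)
    (by positivity) (fun x hx hxq => by
      have h1 := hclose x hx hxq
      have h2 := dist_triangle_right p x q
      linarith)
  intro z hz
  have hz' := hz _ ⟨?_, hK⟩
  · exact hclose z hz'.1 hz'.2
  · intro x hx
    rw [mem_closedBall] at hx
    have hxR : x ∈ ball p R := by
      rw [mem_ball']
      linarith [dist_triangle_right p x q]
    refine ⟨hxR, ?_⟩
    have := dist_extChartAt_le (R := R / 2) (inv_pos.2 hL0) hlow (x := x) (y := q) (by linarith)
      (fun w hw => hR w (by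
        rw [mem_ball'] at hw ⊢
        linarith [dist_triangle_right p x q, dist_triangle p x w]))
    rw [inv_inv] at this
    exact this.trans (by gcongr)

end Hull

/-! ### Local volume bounds for balls. -/

section Volume

variable {n : ℕ} {M : Type*} [MetricSpace M] [ChartedSpace (EuclideanSpace ℝ (Fin n)) M]
  [IsManifold (𝓡 n) ∞ M] [Bundle.RiemannianBundle (fun x : M => TangentSpace (𝓡 n) x)]
  [IsContMDiffRiemannianBundle (𝓡 n) ∞ (EuclideanSpace ℝ (Fin n))
    (fun x : M => TangentSpace (𝓡 n) x)]
  [IsRiemannianManifold (𝓡 n) M] [MeasurableSpace M] [BorelSpace M]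

/-- The normalizing constant depends only on `n`, so it is the same on both spaces and the Lipschitz
bound for the Hausdorff measure carries over. -/
theorem euclideanHausdorffMeasure_image_le {X Y : Type*} [EMetricSpace X] [EMetricSpace Y]
    [MeasurableSpace X] [BorelSpace X] [MeasurableSpace Y] [BorelSpace Y] (n : ℕ) {K : ℝ≥0}
    {f : X → Y} {s : Set X} (h : LipschitzOnWith K f s) :
    μHE[n] (f '' s) ≤ (K : ℝ≥0∞) ^ n * μHE[n] s := by
  rw [Measure.euclideanHausdorffMeasure_def, Measure.euclideanHausdorffMeasure_def,
    Measure.smul_apply, Measure.smul_apply, ENNReal.smul_def, ENNReal.smul_def, smul_eq_mul,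
    smul_eq_mul, mul_left_comm]
  gcongr
  have := h.hausdorffMeasure_image_le (d := n) (Nat.cast_nonneg n)
  rwa [ENNReal.rpow_natCast] at this

/-- The volume of small balls, locally uniformly. -/
theorem exists_volume_closedBall_le (p : M) :
    ∃ δ > 0, ∃ C > 0, ∀ q ∈ ball p δ, ∀ d, 0 < d → d < δ →
      μHE[n] (closedBall q d) ≤ ENNReal.ofReal (C * d ^ n) := by
  obtain ⟨r₀, L, hr₀, hL, htarget, hbd⟩ := exists_chart_bounds (E := EuclideanSpace ℝ (Fin n)) p
  obtain ⟨R, hR0, hR⟩ := exists_ball_subset_chart (E := EuclideanSpace ℝ (Fin n)) p hr₀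
  have hL0 : 0 < L := by linarith
  set φ := extChartAt (𝓡 n) p with hφ
  set V : ℝ := (volume (ball (0 : EuclideanSpace ℝ (Fin n)) 1)).toReal with hV
  -- One factor `L ^ n` comes from the Lipschitz constant of the inverse chart, the other from the
  -- radius `L * d` of the chart ball; `V + 1` makes positivity immediate.
  refine ⟨R / 4, by positivity, L ^ n * L ^ n * (V + 1), by positivity, ?_⟩
  intro q hq d hd hdR
  rw [mem_ball'] at hq
  have hin : ∀ x ∈ closedBall q d, x ∈ ball p R := fun x hx => by
    rw [mem_closedBall'] at hx
    rw [mem_ball']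
    linarith [dist_triangle p q x]
  have hlip : LipschitzOnWith L.toNNReal φ.symm (closedBall (φ q) (L * d) ∩ ball (φ p) r₀) := by
    refine LipschitzOnWith.of_dist_le_mul fun u hu w hw => ?_
    rw [Real.coe_toNNReal _ hL0.le]
    exact dist_extChartAt_symm_le hL0.le (convex_ball (φ p) r₀) htarget
      (fun u hu v => (hbd u hu v).2) hu.2 hw.2
  have hsub : closedBall q d ⊆ φ.symm '' (closedBall (φ q) (L * d) ∩ ball (φ p) r₀) := by
    intro x hx
    have hx' := hR x (hin x hx)
    refine ⟨φ x, ⟨?_, hx'.2⟩, φ.left_inv (by rw [hφ, extChartAt_source]; exact hx'.1)⟩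
    rw [mem_closedBall] at hx ⊢
    have := dist_extChartAt_le (R := R / 2) (inv_pos.2 hL0) (fun u hu v => (hbd u hu v).1)
      (x := x) (y := q) (by linarith) (fun w hw => hR w (by
        rw [mem_ball'] at hw ⊢
        linarith [dist_triangle p q x, dist_triangle p x w, dist_comm x q]))
    rw [inv_inv] at this
    exact this.trans (by gcongr)
  refine (measure_mono hsub).trans ((euclideanHausdorffMeasure_image_le n hlip).trans ?_)
  rw [EuclideanSpace.euclideanHausdorffMeasure_eq_volume]
  refine (mul_le_mul_right (measure_mono inter_subset_left) _).trans ?_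
  rw [Measure.addHaar_closedBall _ _ (by positivity), finrank_euclideanSpace_fin]
  have hfin : volume (ball (0 : EuclideanSpace ℝ (Fin n)) 1) ≠ ⊤ := measure_ball_lt_top.ne
  rw [← ENNReal.ofReal_toReal hfin, ← hV]
  have hc : ((L.toNNReal : ℝ≥0) : ℝ≥0∞) = ENNReal.ofReal L := rfl
  rw [hc, ← ENNReal.ofReal_pow hL0.le, ← ENNReal.ofReal_mul (by positivity),
    ← ENNReal.ofReal_mul (by positivity)]
  refine ENNReal.ofReal_le_ofReal ?_
  rw [mul_pow]
  have : 0 ≤ L ^ n * L ^ n * d ^ n := by positivity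
  nlinarith

end Volume

end LocalGeometry

/-! ### Uniform constants by compactness. -/

section GlobalGeometry
open Metric
open scoped Topology NNReal ENNReal

/-- Locally uniform estimates at small scales are uniform on a compact space. -/
theorem exists_uniform_of_locally_uniform {M : Type*} [MetricSpace M] [CompactSpace M]
    {P : M → ℝ → ℝ → Prop} (hmono : ∀ q d C C', 0 < d → C ≤ C' → P q d C → P q d C')
    (h : ∀ p, ∃ δ > 0, ∃ C > 0, ∀ q ∈ ball p δ, ∀ d, 0 < d → d < δ → P q d C) :
    ∃ δ > 0, ∃ C > 0, ∀ q, ∀ d, 0 < d → d < δ → P q d C := by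
  have key : ∃ δ > 0, ∃ C > 0, ∀ q ∈ (univ : Set M), ∀ d, 0 < d → d < δ → P q d C := by
    refine isCompact_univ.induction_on (p := fun s => ∃ δ > 0, ∃ C > 0, ∀ q ∈ s, ∀ d, 0 < d →
      d < δ → P q d C) ⟨1, one_pos, 1, one_pos, by simp⟩ ?_ ?_ ?_
    · rintro s t hst ⟨δ, hδ, C, hC, H⟩
      exact ⟨δ, hδ, C, hC, fun q hq => H q (hst hq)⟩
    · rintro s t ⟨δ, hδ, C, hC, H⟩ ⟨δ', hδ', C', hC', H'⟩
      refine ⟨min δ δ', lt_min hδ hδ', max C C', lt_max_of_lt_left hC, ?_⟩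
      rintro q (hq | hq) d hd hdδ
      · exact hmono q d _ _ hd (le_max_left _ _) (H q hq d hd (hdδ.trans_le (min_le_left _ _)))
      · exact hmono q d _ _ hd (le_max_right _ _) (H' q hq d hd (hdδ.trans_le (min_le_right _ _)))
    · intro p _
      obtain ⟨δ, hδ, C, hC, H⟩ := h p
      exact ⟨ball p δ, mem_nhdsWithin_of_mem_nhds (ball_mem_nhds p hδ), δ, hδ, C, hC, H⟩
  simpa using key

theorem subset_geodesicHull {M : Type*} [MetricSpace M] (A : Set M) : A ⊆ geodesicHull A :=
  fun _ hx _ hK => hK.1 hx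

theorem geodesicHull_mono {M : Type*} [MetricSpace M] {A B : Set M} (h : A ⊆ B) :
    geodesicHull A ⊆ geodesicHull B :=
  fun _ hx K hK => hx K ⟨h.trans hK.1, hK.2⟩

/-- The geodesic hull of a set has a diameter comparable to that of the set. -/
theorem exists_dist_geodesicHull_le (n : ℕ) (M : Type*) [MetricSpace M] [CompactSpace M]
    [ChartedSpace (EuclideanSpace ℝ (Fin n)) M]
    [IsManifold (𝓡 n) ∞ M] [Bundle.RiemannianBundle (fun x : M => TangentSpace (𝓡 n) x)]
    [IsContMDiffRiemannianBundle (𝓡 n) ∞ (EuclideanSpace ℝ (Fin n))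
      (fun x : M => TangentSpace (𝓡 n) x)]
    [IsRiemannianManifold (𝓡 n) M] :
    ∃ C > 0, ∀ A : Set M, 0 < diam A → ∀ x ∈ geodesicHull A, ∀ y ∈ geodesicHull A,
      dist x y ≤ C * diam A := by
  obtain ⟨δ, hδ, C, hC, H⟩ := exists_uniform_of_locally_uniform
    (P := fun (q : M) d C => geodesicHull (closedBall q d) ⊆ closedBall q (C * d))
    (fun q d C C' hd hCC' h => h.trans (closedBall_subset_closedBall (by gcongr)))
    (exists_geodesicHull_closedBall_subset (EuclideanSpace ℝ (Fin n)))
  have hb : Bornology.IsBounded (univ : Set M) := isCompact_univ.isBounded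
  -- The second entry covers sets of diameter at least `δ`, for which the diameter of the whole
  -- manifold is an adequate bound.
  refine ⟨max (2 * C) (diam (univ : Set M) / δ), lt_max_of_lt_left (by positivity), ?_⟩
  intro A hA x hx y hy
  rcases lt_or_ge (diam A) δ with hlt | hge
  · obtain ⟨q, hq⟩ : A.Nonempty := by
      by_contra h
      rw [not_nonempty_iff_eq_empty.1 h, diam_empty] at hA
      exact lt_irrefl _ hA
    have hsub : A ⊆ closedBall q (diam A) := fun z hz =>
      dist_le_diam_of_mem (hb.subset (subset_univ A)) hz hq
    have hx' := H q _ hA hlt (geodesicHull_mono hsub hx)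
    have hy' := H q _ hA hlt (geodesicHull_mono hsub hy)
    rw [mem_closedBall] at hx' hy'
    calc dist x y ≤ dist x q + dist y q := dist_triangle_right _ _ _
      _ ≤ 2 * C * diam A := by linarith
      _ ≤ _ := by gcongr; exact le_max_left _ _
  · calc dist x y ≤ diam (univ : Set M) := dist_le_diam_of_mem hb (mem_univ _) (mem_univ _)
      _ = diam (univ : Set M) / δ * δ := by field_simp
      _ ≤ diam (univ : Set M) / δ * diam A := by gcongr
      _ ≤ _ := by gcongr; exact le_max_right _ _

/-- The volume of a ball is at most a constant multiple of the power of its radius. -/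
theorem exists_volume_le (n : ℕ) (M : Type*) [MetricSpace M] [CompactSpace M]
    [ChartedSpace (EuclideanSpace ℝ (Fin n)) M]
    [IsManifold (𝓡 n) ∞ M] [Bundle.RiemannianBundle (fun x : M => TangentSpace (𝓡 n) x)]
    [IsContMDiffRiemannianBundle (𝓡 n) ∞ (EuclideanSpace ℝ (Fin n))
      (fun x : M => TangentSpace (𝓡 n) x)]
    [IsRiemannianManifold (𝓡 n) M] [MeasurableSpace M] [BorelSpace M] :
    ∃ C > 0, ∀ (q : M) (d : ℝ), 0 < d → μHE[n] (closedBall q d) ≤ ENNReal.ofReal (C * d ^ n) := by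
  obtain ⟨δ, hδ, C, hC, H⟩ := exists_uniform_of_locally_uniform
    (P := fun (q : M) d C => μHE[n] (closedBall q d) ≤ ENNReal.ofReal (C * d ^ n))
    (fun q d C C' hd hCC' h => h.trans (ENNReal.ofReal_le_ofReal (by gcongr)))
    exists_volume_closedBall_le
  -- Small balls have finite volume, so by compactness the total volume is finite; it bounds the
  -- volume of balls of radius at least `δ`.
  have hfin : μHE[n] (univ : Set M) < ⊤ := by
    refine IsCompact.measure_lt_top_of_nhdsWithin isCompact_univ fun x _ => ?_
    refine ⟨closedBall x (δ / 2), mem_nhdsWithin_of_mem_nhds (closedBall_mem_nhds x (by positivity)),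
      (H x (δ / 2) (by positivity) (by linarith)).trans_lt ENNReal.ofReal_lt_top⟩
  set V := (μHE[n] (univ : Set M)).toReal with hV
  refine ⟨max C (V / δ ^ n), lt_max_of_lt_left hC, fun q d hd => ?_⟩
  rcases lt_or_ge d δ with hlt | hge
  · refine (H q d hd hlt).trans (ENNReal.ofReal_le_ofReal ?_)
    gcongr
    exact le_max_left _ _
  · refine (measure_mono (subset_univ _)).trans ?_
    rw [← ENNReal.ofReal_toReal hfin.ne, ← hV]
    refine ENNReal.ofReal_le_ofReal ?_
    calc V = V / δ ^ n * δ ^ n := by field_simp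
      _ ≤ V / δ ^ n * d ^ n := by gcongr
      _ ≤ _ := by gcongr; exact le_max_right _ _

end GlobalGeometry

/-! ### Counting wavelets near a given one. -/

section Counting
open Metric
open scoped Topology NNReal ENNReal

/-- Sets that meet at most `m` of each other in positive measure have a total measure of at most
`m` times the measure of a set that contains them. -/
theorem sum_measure_le_of_overlap {X ι : Type*} [MeasurableSpace X] {μ : Measure X}
    {s : Finset ι} {T : ι → Set X} {B : Set X} {m : ℕ} (hT : ∀ i ∈ s, MeasurableSet (T i))
    (hB : MeasurableSet B) (hTB : ∀ i ∈ s, T i ⊆ B)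
    (hm : ∀ i ∈ s, {i' | i' ∈ s ∧ μ (T i ∩ T i') ≠ 0}.ncard ≤ m) :
    ∑ i ∈ s, μ (T i) ≤ m * μ B := by
  classical
  -- Off a null set, any two sets sharing a point overlap in positive measure. Then the sets through
  -- `x` are among the neighbours of any one of them, so there are at most `m`.
  have hnull : ∀ᵐ x ∂μ, ∀ i ∈ s, ∀ i' ∈ s, μ (T i ∩ T i') = 0 → x ∉ T i ∩ T i' := by
    refine (Finset.eventually_all s).2 fun i _ => (Finset.eventually_all s).2 fun i' _ => ?_
    by_cases h : μ (T i ∩ T i') = 0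
    · filter_upwards [measure_eq_zero_iff_ae_notMem.1 h] with x hx _ using hx
    · exact Filter.Eventually.of_forall fun x hx => absurd hx h
  calc ∑ i ∈ s, μ (T i) = ∑ i ∈ s, ∫⁻ x, (T i).indicator 1 x ∂μ :=
        Finset.sum_congr rfl fun i hi => (lintegral_indicator_one (hT i hi)).symm
    _ = ∫⁻ x, ∑ i ∈ s, (T i).indicator 1 x ∂μ :=
        (lintegral_finsetSum' s fun i hi => (aemeasurable_one.indicator (hT i hi))).symm
    _ ≤ ∫⁻ x, m * B.indicator 1 x ∂μ := by
        refine lintegral_mono_ae ?_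
        filter_upwards [hnull] with x hx
        by_cases hex : ∃ i ∈ s, x ∈ T i
        · obtain ⟨i, hi, hxi⟩ := hex
          have h1 : ∑ i ∈ s, (T i).indicator (1 : X → ℝ≥0∞) x = (s.filter (x ∈ T ·)).card := by
            simp [Set.indicator_apply]
          rw [h1, indicator_of_mem (hTB i hi hxi), Pi.one_apply, mul_one]
          have h2 : (s.filter (x ∈ T ·)).card ≤ m := by
            refine le_trans ?_ (hm i hi)
            rw [← Set.ncard_coe_finset]
            refine Set.ncard_le_ncard ?_ (s.finite_toSet.subset fun i' hi' => hi'.1)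
            intro i' hi'
            have hi'' := Finset.mem_filter.1 (Finset.mem_coe.1 hi')
            exact ⟨hi''.1, fun h0 => hx i hi i' hi''.1 h0 ⟨hxi, hi''.2⟩⟩
          exact_mod_cast h2
        · push Not at hex
          rw [Finset.sum_eq_zero fun i hi => indicator_of_notMem (hex i hi) _]
          exact zero_le
    _ = m * μ B := by
        rw [lintegral_const_mul' _ _ (ENNReal.natCast_ne_top m), lintegral_indicator_one hB]

theorem setDist_comm {M : Type*} [MetricSpace M] (A B : Set M) : setDist A B = setDist B A := by
  rw [setDist, setDist, image2_swap]
  simp_rw [dist_comm]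

variable {M : Type*} [MetricSpace M] [MeasurableSpace M] [BorelSpace M] {n : ℕ}
  {κ : ℕ → Type*} [∀ j, Fintype (κ j)]

/-- The number of wavelets of a level whose hull is close to the hull of a given wavelet. -/
theorem BiorthogonalWavelets.exists_ncard_le (W : BiorthogonalWavelets M n κ) {CH CV : ℝ}
    (hCH : 0 < CH) (hH : ∀ A : Set M, 0 < diam A → ∀ x ∈ geodesicHull A, ∀ y ∈ geodesicHull A,
      dist x y ≤ CH * diam A)
    (hCV : 0 < CV) (hV : ∀ (q : M) (d : ℝ), 0 < d →
      μHE[n] (closedBall q d) ≤ ENNReal.ofReal (CV * d ^ n)) :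
    ∃ K : ℝ, 0 < K ∧ ∀ (l : WaveletIndex κ W.j₀) (j' : Set.Ici W.j₀) (τ : ℝ),
      ((2 : ℝ) ^ (l.1 : ℕ))⁻¹ ≤ τ → ((2 : ℝ) ^ (j' : ℕ))⁻¹ ≤ τ →
      ({k' : κ j' | setDist (W.hull l) (W.hull ⟨j', k'⟩) ≤ τ}.ncard : ℝ) ≤
        K * (2 ^ ((j' : ℕ) * n) * τ ^ n) := by
  classical
  obtain ⟨Cd, hCd, hdiam⟩ := W.diam_supp
  obtain ⟨c, hc, hvol⟩ := W.vol_supp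
  obtain ⟨m, hm⟩ := W.overlap
  -- A point of a nearby support is joined to `x₀` across two hulls of diameter at most `CH * Cd *
  -- τ` and a gap below `2 * τ`.
  set R := 2 + 2 * (CH * Cd) with hR
  refine ⟨(m + 1) * (CV * R ^ n) / c, by positivity, ?_⟩
  intro l j' τ hl hj'
  have hτ : 0 < τ := lt_of_lt_of_le (by positivity) hl
  have hpos : ∀ l, 0 < diam (tsupport (W.ψ l)) := fun l =>
    lt_of_lt_of_le (by positivity) (hdiam l).1
  have hne : ∀ l, (tsupport (W.ψ l)).Nonempty := fun l => by
    by_contra h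
    have := hpos l
    rw [not_nonempty_iff_eq_empty.1 h, diam_empty] at this
    exact lt_irrefl _ this
  have hhull : ∀ l, ((2 : ℝ) ^ (l.1 : ℕ))⁻¹ ≤ τ → ∀ x ∈ W.hull l, ∀ y ∈ W.hull l,
      dist x y ≤ CH * Cd * τ := fun l hl x hx y hy => by
    refine (hH _ (hpos l) x hx y hy).trans ?_
    rw [mul_assoc]
    gcongr
    exact (hdiam l).2.trans (by gcongr)
  obtain ⟨x₀, hx₀⟩ := hne l
  set S : Finset (κ j') :=
    Finset.univ.filter fun k' => setDist (W.hull l) (W.hull ⟨j', k'⟩) ≤ τ with hS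
  have hSc : {k' : κ j' | setDist (W.hull l) (W.hull ⟨j', k'⟩) ≤ τ}.ncard = S.card := by
    rw [← Set.ncard_coe_finset]
    congr 1
    ext k'
    simp [hS]
  have hsub : ∀ k' ∈ S, tsupport (W.ψ ⟨j', k'⟩) ⊆ closedBall x₀ (R * τ) := by
    intro k' hk' z hz
    -- The infimum need not be attained; the strict bound yields an actual pair of points.
    have h1 : setDist (W.hull l) (W.hull ⟨j', k'⟩) < 2 * τ := by
      have := (Finset.mem_filter.1 hk').2
      linarith
    obtain ⟨d, ⟨x, hx, y, hy, rfl⟩, hd⟩ := exists_lt_of_csInf_lt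
      (Set.Nonempty.image2 ((hne l).mono (subset_geodesicHull _))
        ((hne ⟨j', k'⟩).mono (subset_geodesicHull _))) h1
    have h2 := hhull l hl x hx x₀ (subset_geodesicHull _ hx₀)
    have h3 := hhull ⟨j', k'⟩ hj' z (subset_geodesicHull _ hz) y hy
    have h4 := dist_triangle4 z y x x₀
    rw [mem_closedBall]
    rw [dist_comm y x] at h4
    rw [hR]
    linarith
  have hsum := sum_measure_le_of_overlap (μ := μHE[n]) (s := S)
    (T := fun k' => tsupport (W.ψ ⟨j', k'⟩)) (m := m)
    (fun k' _ => (isClosed_tsupport _).measurableSet) isClosed_closedBall.measurableSet hsub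
    (fun k' _ => (Set.ncard_le_ncard (fun i hi => hi.2) (Set.toFinite _)).trans (hm j' k'))
  have h1 : (S.card : ℝ≥0∞) * ENNReal.ofReal (c * (2 ^ ((j' : ℕ) * n))⁻¹) ≤
      m * ENNReal.ofReal (CV * (R * τ) ^ n) := by
    refine le_trans ?_ (hsum.trans (mul_le_mul_right (hV x₀ _ (by positivity)) _))
    rw [← nsmul_eq_mul]
    exact Finset.card_nsmul_le_sum _ _ _ fun k' _ => hvol ⟨j', k'⟩
  rw [← ENNReal.ofReal_natCast, ← ENNReal.ofReal_natCast, ← ENNReal.ofReal_mul (by positivity),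
    ← ENNReal.ofReal_mul (by positivity), ENNReal.ofReal_le_ofReal_iff (by positivity)] at h1
  rw [hSc]
  have h2 : (S.card : ℝ) * c ≤ m * (CV * (R * τ) ^ n) * 2 ^ ((j' : ℕ) * n) := by
    rw [← mul_assoc, ← div_eq_mul_inv, div_le_iff₀ (by positivity)] at h1
    exact h1
  rw [div_mul_eq_mul_div, le_div_iff₀ hc]
  refine h2.trans ?_
  rw [mul_pow]
  have : 0 ≤ CV * R ^ n * (2 ^ ((j' : ℕ) * n) * τ ^ n) := by positivity
  nlinarith

end Counting

/-! ### Geometric sums over levels. -/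

section Sums

/-- Rounding `s` down to an integer only increases the terms, which then form part of the geometric
series. -/
theorem sum_rpow_sub_le {q : ℝ} (hq0 : 0 < q) (hq1 : q < 1) (F : Finset ℕ) (s : ℝ)
    (hF : ∀ i ∈ F, (i : ℝ) ≤ s) : ∑ i ∈ F, q ^ (s - i) ≤ (1 - q)⁻¹ := by
  have hsub : F ⊆ Finset.range (⌊s⌋₊ + 1) := fun i hi =>
    Finset.mem_range.2 (Nat.lt_succ_of_le (Nat.le_floor (hF i hi)))
  rcases F.eq_empty_or_nonempty with rfl | ⟨i₀, hi₀⟩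
  · simp [hq1.le]
  have hs : 0 ≤ s := (Nat.cast_nonneg i₀).trans (hF i₀ hi₀)
  calc ∑ i ∈ F, q ^ (s - i) ≤ ∑ i ∈ F, q ^ (⌊s⌋₊ - i) := by
        refine Finset.sum_le_sum fun i hi => ?_
        have hi' : i ≤ ⌊s⌋₊ := Nat.le_floor (hF i hi)
        rw [← Real.rpow_natCast, Nat.cast_sub hi']
        refine Real.rpow_le_rpow_of_exponent_ge hq0 hq1.le ?_
        linarith [Nat.floor_le hs]
    _ ≤ ∑ i ∈ Finset.range (⌊s⌋₊ + 1), q ^ (⌊s⌋₊ - i) :=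
        Finset.sum_le_sum_of_subset_of_nonneg hsub fun i _ _ => by positivity
    _ = ∑ i ∈ Finset.range (⌊s⌋₊ + 1), q ^ i := by
        have := Finset.sum_range_reflect (fun i => q ^ i) (⌊s⌋₊ + 1)
        simpa using this
    _ ≤ ∑' i, q ^ i := (summable_geometric_of_lt_one hq0.le hq1).sum_le_tsum _ fun i _ => by
        positivity
    _ = (1 - q)⁻¹ := tsum_geometric_of_lt_one hq0.le hq1

/-- A geometric sum in powers of two with a top exponent. -/
theorem exists_sum_two_rpow_le {x : ℝ} (hx : 0 < x) : ∃ C : ℝ, 0 < C ∧ ∀ (F : Finset ℕ) (s : ℝ),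
    (∀ i ∈ F, (i : ℝ) ≤ s) → ∑ i ∈ F, (2 : ℝ) ^ (-(x * (s - i))) ≤ C := by
  have hq1 : (2 : ℝ) ^ (-x) < 1 := Real.rpow_lt_one_of_one_lt_of_neg one_lt_two (by linarith)
  refine ⟨(1 - (2 : ℝ) ^ (-x))⁻¹, inv_pos.2 (by linarith), fun F s hF => ?_⟩
  refine le_trans (le_of_eq ?_) (sum_rpow_sub_le (by positivity) hq1 F s hF)
  refine Finset.sum_congr rfl fun i _ => ?_
  rw [← Real.rpow_mul zero_le_two, neg_mul]

/-- Absorbs the number of levels, for those blocks that contribute only a bounded number of entries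
to a row. -/
theorem exists_add_one_le_two_rpow {c : ℝ} (hc : 0 < c) :
    ∃ C : ℝ, 0 < C ∧ ∀ J : ℕ, (J : ℝ) + 1 ≤ C * (2 : ℝ) ^ (c * J) := by
  have hl : 0 < Real.log 2 := Real.log_pos one_lt_two
  refine ⟨max 1 (1 / (Real.log 2 * c)), by positivity, fun J => ?_⟩
  have h1 : Real.log 2 * (c * J) + 1 ≤ (2 : ℝ) ^ (c * J) := by
    rw [Real.rpow_def_of_pos zero_lt_two]
    exact Real.add_one_le_exp _
  set m := max 1 (1 / (Real.log 2 * c)) with hm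
  have h2 : 1 ≤ m := le_max_left _ _
  have h3 : 1 ≤ m * (Real.log 2 * c) := by
    have : 1 / (Real.log 2 * c) ≤ m := le_max_right _ _
    rwa [div_le_iff₀ (by positivity)] at this
  have hJ : (0 : ℝ) ≤ J := Nat.cast_nonneg J
  calc (J : ℝ) + 1 ≤ m * (Real.log 2 * c) * J + m := by nlinarith
    _ = m * (Real.log 2 * (c * J) + 1) := by ring
    _ ≤ _ := by gcongr

/-- The level exponent in the shifted parameters `A = t - r/2`, `B = t' - r/2`, `D = d̃ + r/2`. -/
def levelExp (A B D : ℝ) (J j j' : ℕ) : ℝ := J * (A + B) - j * (D + B) - j' * (D + A)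

/-- The threshold in the shifted parameters. -/
def threshold (A B D a : ℝ) (J j j' : ℕ) : ℝ :=
  a * max ((2 : ℝ) ^ (-(min j j' : ℕ) : ℝ)) ((2 : ℝ) ^ (levelExp A B D J j j' / (2 * D)))

/-- The slope conditions in the shifted parameters, with `S = σ - n/2`. -/
def SlopeCond (A B S : ℝ) (J j j' : ℕ) : Prop :=
  j * (S + B) ≤ (A + B) * J + (S - A) * j' ∧ j' * (S + A) ≤ (A + B) * J + (S - B) * j

theorem levelExp_comm (A B D : ℝ) (J j j' : ℕ) : levelExp A B D J j j' = levelExp B A D J j' j := by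
  simp only [levelExp]; ring

theorem threshold_comm (A B D a : ℝ) (J j j' : ℕ) :
    threshold A B D a J j j' = threshold B A D a J j' j := by
  rw [threshold, threshold, min_comm, levelExp_comm]

theorem slopeCond_comm (A B S : ℝ) (J j j' : ℕ) :
    SlopeCond A B S J j j' ↔ SlopeCond B A S J j' j := by
  rw [SlopeCond, SlopeCond, and_comm, add_comm A B]

variable {A B S D a : ℝ} {n : ℕ}

theorem two_rpow_neg_min_le_threshold (ha : 1 ≤ a) (J j j' : ℕ) :
    (2 : ℝ) ^ (-(min j j' : ℕ) : ℝ) ≤ threshold A B D a J j j' := by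
  refine (le_max_left _ _).trans (le_mul_of_one_le_left ?_ ha)
  exact le_max_of_le_left (by positivity)

/-- A maximum is at most a sum, so the two regimes of the threshold can be summed separately. -/
theorem threshold_pow_le (ha : 0 ≤ a) (n J j j' : ℕ) :
    threshold A B D a J j j' ^ n ≤ a ^ n * ((2 : ℝ) ^ (-((min j j' : ℕ) : ℝ) * n) +
      (2 : ℝ) ^ (levelExp A B D J j j' / (2 * D) * n)) := by
  rw [threshold, mul_pow, Real.rpow_mul_natCast zero_le_two, Real.rpow_mul_natCast zero_le_two]
  gcongr
  rcases max_cases ((2 : ℝ) ^ (-(min j j' : ℕ) : ℝ))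
    ((2 : ℝ) ^ (levelExp A B D J j j' / (2 * D))) with h | h <;> rw [h.1]
  · exact le_add_of_nonneg_right (by positivity)
  · exact le_add_of_nonneg_left (by positivity)

/-- The number of entries in a row of the blocks with slope conditions. -/
theorem exists_row_sum_le (hn : 0 < n) (hA : 0 < A) (hB : 0 < B) (hAS : A < S)
    (hSD : S < D) (ha : 0 < a) : ∃ C : ℝ, 0 < C ∧ ∀ (J j : ℕ) (F : Finset ℕ), j ≤ J →
      (∀ j' ∈ F, j' ≤ J ∧ SlopeCond A B S J j j') →
      ∑ j' ∈ F, 2 ^ (j' * n) * threshold A B D a J j j' ^ n ≤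
        C * (2 : ℝ) ^ (J * n * (A + B) / (S + A)) := by
  have hn' : (0 : ℝ) < n := Nat.cast_pos.2 hn
  have hD : 0 < D := by linarith
  have hDA : 0 < D - A := by linarith
  have hSA : 0 < S + A := by linarith
  obtain ⟨C₁, hC₁, H₁⟩ := exists_sum_two_rpow_le hn'
  obtain ⟨C₂, hC₂, H₂⟩ := exists_sum_two_rpow_le (x := n * (D - A) / (2 * D)) (by positivity)
  obtain ⟨C₃, hC₃, H₃⟩ := exists_add_one_le_two_rpow (c := n * (A + B) / (S + A)) (by positivity)
  refine ⟨a ^ n * (C₁ + C₂ + C₃), by positivity, ?_⟩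
  intro J j F hj hF
  have hjJ : (j : ℝ) ≤ J := Nat.cast_le.2 hj
  have hj0 : (0 : ℝ) ≤ j := Nat.cast_nonneg j
  -- The slope bound for `j'`, in general not an integer; both geometric sums have it as top
  -- exponent.
  set s : ℝ := ((A + B) * J + (S - B) * j) / (S + A) with hs
  have hsF : ∀ j' ∈ F, (j' : ℝ) ≤ s := fun j' hj' => by
    rw [hs, le_div_iff₀ hSA]
    exact (hF j' hj').2.2
  set X : ℝ := J * n * (A + B) / (S + A) with hX
  have hsX : n * (s - j) ≤ X := by
    have : s - j = (A + B) * (J - j) / (S + A) := by rw [hs]; field_simp; ring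
    rw [this, hX, ← mul_div_assoc]
    have h1 : 0 ≤ (n : ℝ) * (A + B) * j := by positivity
    exact div_le_div_of_nonneg_right (by linarith) hSA.le
  -- The exponent of the level term at `j' = s`. It does not increase with `j`, and at `j = 0` the
  -- bound reduces to `S + D ≤ 2 * D`.
  have hsX' : n / (2 * D) * (J * (A + B) - j * (D + B) + s * (D - A)) ≤ X := by
    have h1 : J * (A + B) - j * (D + B) + s * (D - A) ≤ 2 * D * (J * (A + B) / (S + A)) := by
      rw [hs]
      have : J * (A + B) - j * (D + B) + ((A + B) * J + (S - B) * j) / (S + A) * (D - A) =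
          ((S + D) * (J * (A + B)) - j * ((D + B) * (S + A) - (S - B) * (D - A))) / (S + A) := by
        field_simp; ring
      rw [this, ← mul_div_assoc]
      gcongr
      have h2 : 0 ≤ (j : ℝ) * ((D + B) * (S + A) - (S - B) * (D - A)) := by
        refine mul_nonneg hj0 ?_
        nlinarith
      have h3 : 0 ≤ (J : ℝ) * (A + B) * (D - S) := by
        have : 0 < D - S := by linarith
        positivity
      linarith
    calc n / (2 * D) * (J * (A + B) - j * (D + B) + s * (D - A))
        ≤ n / (2 * D) * (2 * D * (J * (A + B) / (S + A))) := by gcongr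
      _ = X := by rw [hX]; field_simp
  have hterm : ∀ j' ∈ F, 2 ^ (j' * n) * threshold A B D a J j j' ^ n ≤
      a ^ n * ((1 + (2 : ℝ) ^ X * (2 : ℝ) ^ (-(n * (s - j')))) +
        (2 : ℝ) ^ X * (2 : ℝ) ^ (-(n * (D - A) / (2 * D) * (s - j')))) := by
    intro j' hj'
    have h1 := threshold_pow_le (A := A) (B := B) (D := D) ha.le n J j j'
    calc 2 ^ (j' * n) * threshold A B D a J j j' ^ n
        ≤ 2 ^ (j' * n) * (a ^ n * ((2 : ℝ) ^ (-((min j j' : ℕ) : ℝ) * n) +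
          (2 : ℝ) ^ (levelExp A B D J j j' / (2 * D) * n))) := by gcongr
      _ = a ^ n * ((2 : ℝ) ^ ((j' : ℝ) * n + -((min j j' : ℕ) : ℝ) * n) +
          (2 : ℝ) ^ ((j' : ℝ) * n + levelExp A B D J j j' / (2 * D) * n)) := by
        rw [Real.rpow_add zero_lt_two, Real.rpow_add zero_lt_two, ← Nat.cast_mul,
          Real.rpow_natCast]
        ring
      _ ≤ _ := by
        gcongr
        · rcases le_total j' j with h | h
          · rw [min_eq_right h]
            have : (j' : ℝ) * n + -(j' : ℝ) * n = 0 := by ring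
            rw [this, Real.rpow_zero]
            exact le_add_of_nonneg_right (by positivity)
          · rw [min_eq_left h, ← Real.rpow_add zero_lt_two]
            refine le_trans ?_ (le_add_of_nonneg_left zero_le_one)
            refine Real.rpow_le_rpow_of_exponent_le one_le_two ?_
            linarith
        · rw [← Real.rpow_add zero_lt_two]
          refine Real.rpow_le_rpow_of_exponent_le one_le_two ?_
          have : (j' : ℝ) * n + levelExp A B D J j j' / (2 * D) * n =
              n / (2 * D) * (J * (A + B) - j * (D + B) + s * (D - A)) +
                -(n * (D - A) / (2 * D) * (s - j')) := by
            rw [levelExp]; field_simp; ring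
          rw [this]
          gcongr
  have hcard : (F.card : ℝ) ≤ J + 1 := by
    have : F ⊆ Finset.range (J + 1) := fun j' hj' =>
      Finset.mem_range.2 (Nat.lt_succ_of_le (hF j' hj').1)
    have := Finset.card_le_card this
    rw [Finset.card_range] at this
    exact_mod_cast this
  have hJX : (J : ℝ) + 1 ≤ C₃ * (2 : ℝ) ^ X := by
    refine (H₃ J).trans_eq ?_
    congr 2
    rw [hX]; ring
  have e₁ := H₁ F s hsF
  have e₂ := H₂ F s hsF
  calc ∑ j' ∈ F, 2 ^ (j' * n) * threshold A B D a J j j' ^ n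
      ≤ ∑ j' ∈ F, a ^ n * ((1 + (2 : ℝ) ^ X * (2 : ℝ) ^ (-(n * (s - j')))) +
        (2 : ℝ) ^ X * (2 : ℝ) ^ (-(n * (D - A) / (2 * D) * (s - j')))) := Finset.sum_le_sum hterm
    _ = a ^ n * ((F.card + (2 : ℝ) ^ X * ∑ j' ∈ F, (2 : ℝ) ^ (-(n * (s - j')))) +
        (2 : ℝ) ^ X * ∑ j' ∈ F, (2 : ℝ) ^ (-(n * (D - A) / (2 * D) * (s - j')))) := by
      rw [← Finset.mul_sum, Finset.sum_add_distrib, Finset.sum_add_distrib, ← Finset.mul_sum,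
        ← Finset.mul_sum, Finset.sum_const, nsmul_eq_mul, mul_one]
    _ ≤ a ^ n * ((C₃ * (2 : ℝ) ^ X + (2 : ℝ) ^ X * C₁) + (2 : ℝ) ^ X * C₂) := by
      gcongr
      exact hcard.trans hJX
    _ = _ := by ring

/-- The number of entries of the blocks with slope conditions. -/
theorem exists_total_sum_le (hn : 0 < n) (hA : 0 < A) (hB : 0 < B) (hAS : A < S) (hBS : B < S)
    (hSD : S < D) (ha : 0 < a) : ∃ C : ℝ, 0 < C ∧ ∀ (J : ℕ) (F : Finset ℕ) (G : ℕ → Finset ℕ),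
      (∀ j ∈ F, j ≤ J) → (∀ j ∈ F, ∀ j' ∈ G j, j' ≤ J ∧ SlopeCond A B S J j j') →
      ∑ j ∈ F, ∑ j' ∈ G j, 2 ^ ((j + j') * n) * threshold A B D a J j j' ^ n ≤
        C * 2 ^ (J * n) := by
  have hn' : (0 : ℝ) < n := Nat.cast_pos.2 hn
  have hD : 0 < D := by linarith
  have hDA : 0 < D - A := by linarith
  have hDB : 0 < D - B := by linarith
  have hSA : 0 < S - A := by linarith
  have hSB : 0 < S - B := by linarith
  have hS : 0 < S := by linarith
  -- The first pair serves the scale term through the slope conditions, the second pair the level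
  -- term.
  set η : ℝ := min (min ((S - A) / (2 * (S + B))) ((S - B) / (2 * (S + A))))
    (min ((D - B) / (2 * D)) ((D - A) / (2 * D))) with hη
  have hη0 : 0 < η := by positivity
  have hη1 : η ≤ (S - A) / (2 * (S + B)) := (min_le_left _ _).trans (min_le_left _ _)
  have hη2 : η ≤ (S - B) / (2 * (S + A)) := (min_le_left _ _).trans (min_le_right _ _)
  have hη3 : η ≤ (D - B) / (2 * D) := (min_le_right _ _).trans (min_le_left _ _)
  have hη4 : η ≤ (D - A) / (2 * D) := (min_le_right _ _).trans (min_le_right _ _)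
  rw [le_div_iff₀ (by positivity)] at hη1 hη2 hη3 hη4
  obtain ⟨C, hC, H⟩ := exists_sum_two_rpow_le (x := η * n) (by positivity)
  refine ⟨a ^ n * 2 * (C * C), by positivity, ?_⟩
  intro J F G hF hG
  have hterm : ∀ j ∈ F, ∀ j' ∈ G j, 2 ^ ((j + j') * n) * threshold A B D a J j j' ^ n ≤
      a ^ n * 2 * 2 ^ (J * n) * (2 : ℝ) ^ (-(η * n * (J - j))) *
        (2 : ℝ) ^ (-(η * n * (J - j'))) := by
    intro j hj j' hj'
    obtain ⟨hj'J, h1, h2⟩ := hG j hj j' hj'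
    have hx : (0 : ℝ) ≤ J - j := sub_nonneg.2 (Nat.cast_le.2 (hF j hj))
    have hy : (0 : ℝ) ≤ J - j' := sub_nonneg.2 (Nat.cast_le.2 hj'J)
    -- Put `x = J - j`, `y = J - j'`. If `j' ≤ j`, the left side is `J - x` and the slope condition
    -- reads `(S - A) * y ≤ (S + B) * x`. Hence `2 * η * y ≤ x`, and `x ≤ y` gives `η * x + η * y ≤
    -- x`.
    have hmin : ((j : ℝ) + j' - (min j j' : ℕ)) ≤ J - η * (J - j) - η * (J - j') := by
      rcases le_total j' j with h | h
      · rw [min_eq_right h]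
        have hxy : (J : ℝ) - j ≤ J - j' := by
          have : (j' : ℝ) ≤ j := Nat.cast_le.2 h
          linarith
        have e1 : (S - A) * (J - j') ≤ (S + B) * (J - j) := by linarith
        have e2 : η * (2 * (S + B)) * (J - j') ≤ (S - A) * (J - j') := by gcongr
        have e3 : 2 * η * (J - j') ≤ J - j := by
          have : (S + B) * (2 * η * (J - j')) ≤ (S + B) * (J - j) := by linarith
          exact le_of_mul_le_mul_left this (by positivity)
        have e4 : η * (J - j) ≤ η * (J - j') := by gcongr
        linarith
      · rw [min_eq_left h]
        have hxy : (J : ℝ) - j' ≤ J - j := by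
          have : (j : ℝ) ≤ j' := Nat.cast_le.2 h
          linarith
        have e1 : (S - B) * (J - j) ≤ (S + A) * (J - j') := by linarith
        have e2 : η * (2 * (S + A)) * (J - j) ≤ (S - B) * (J - j) := by gcongr
        have e3 : 2 * η * (J - j) ≤ J - j' := by
          have : (S + A) * (2 * η * (J - j)) ≤ (S + A) * (J - j') := by linarith
          exact le_of_mul_le_mul_left this (by positivity)
        have e4 : η * (J - j') ≤ η * (J - j) := by gcongr
        linarith
    -- The left side equals `J - ((D - B) * (J - j) + (D - A) * (J - j')) / (2 * D)`.
    have hlev : (j : ℝ) + j' + levelExp A B D J j j' / (2 * D) ≤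
        J - η * (J - j) - η * (J - j') := by
      have e1 : η * (2 * D) * (J - j) ≤ (D - B) * (J - j) := by gcongr
      have e2 : η * (2 * D) * (J - j') ≤ (D - A) * (J - j') := by gcongr
      have : (2 * D) * ((j : ℝ) + j' + levelExp A B D J j j' / (2 * D)) ≤
          (2 * D) * (J - η * (J - j) - η * (J - j')) := by
        have e3 : (2 * D) * ((j : ℝ) + j' + levelExp A B D J j j' / (2 * D)) =
          2 * D * (j + j') + (J * (A + B) - j * (D + B) - j' * (D + A)) := by
          rw [levelExp]; field_simp
        rw [e3]
        linarith
      exact le_of_mul_le_mul_left this (by positivity)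
    have h1 := threshold_pow_le (A := A) (B := B) (D := D) ha.le n J j j'
    have hpow : ∀ y : ℝ, y ≤ J - η * (J - j) - η * (J - j') →
        (2 : ℝ) ^ (y * n) ≤ 2 ^ (J * n) * (2 : ℝ) ^ (-(η * n * (J - j))) *
          (2 : ℝ) ^ (-(η * n * (J - j'))) := fun y hy => by
      rw [← Real.rpow_natCast, ← Real.rpow_add zero_lt_two, ← Real.rpow_add zero_lt_two]
      refine Real.rpow_le_rpow_of_exponent_le one_le_two ?_
      push_cast
      have := mul_le_mul_of_nonneg_right hy hn'.le
      linarith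
    calc 2 ^ ((j + j') * n) * threshold A B D a J j j' ^ n
        ≤ 2 ^ ((j + j') * n) * (a ^ n * ((2 : ℝ) ^ (-((min j j' : ℕ) : ℝ) * n) +
          (2 : ℝ) ^ (levelExp A B D J j j' / (2 * D) * n))) := by gcongr
      _ = a ^ n * ((2 : ℝ) ^ (((j : ℝ) + j' - (min j j' : ℕ)) * n) +
          (2 : ℝ) ^ (((j : ℝ) + j' + levelExp A B D J j j' / (2 * D)) * n)) := by
        have e1 : ((j : ℝ) + j' - (min j j' : ℕ)) * n = (((j + j') * n : ℕ) : ℝ) +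
          -((min j j' : ℕ) : ℝ) * n := by push_cast; ring
        have e2 : ((j : ℝ) + j' + levelExp A B D J j j' / (2 * D)) * n =
          (((j + j') * n : ℕ) : ℝ) + levelExp A B D J j j' / (2 * D) * n := by push_cast; ring
        rw [e1, e2, Real.rpow_add zero_lt_two, Real.rpow_add zero_lt_two, Real.rpow_natCast]
        ring
      _ ≤ a ^ n * (2 ^ (J * n) * (2 : ℝ) ^ (-(η * n * (J - j))) *
          (2 : ℝ) ^ (-(η * n * (J - j'))) + 2 ^ (J * n) * (2 : ℝ) ^ (-(η * n * (J - j))) *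
          (2 : ℝ) ^ (-(η * n * (J - j')))) := by
        gcongr
        · exact hpow _ hmin
        · exact hpow _ hlev
      _ = _ := by ring
  calc ∑ j ∈ F, ∑ j' ∈ G j, 2 ^ ((j + j') * n) * threshold A B D a J j j' ^ n
      ≤ ∑ j ∈ F, ∑ j' ∈ G j, a ^ n * 2 * 2 ^ (J * n) * (2 : ℝ) ^ (-(η * n * (J - j))) *
        (2 : ℝ) ^ (-(η * n * (J - j'))) :=
        Finset.sum_le_sum fun j hj => Finset.sum_le_sum fun j' hj' => hterm j hj j' hj'
    _ ≤ ∑ j ∈ F, a ^ n * 2 * 2 ^ (J * n) * (2 : ℝ) ^ (-(η * n * (J - j))) * C := by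
        refine Finset.sum_le_sum fun j hj => ?_
        rw [← Finset.mul_sum]
        gcongr
        exact H (G j) J fun j' hj' => Nat.cast_le.2 (hG j hj j' hj').1
    _ = a ^ n * 2 * 2 ^ (J * n) * (∑ j ∈ F, (2 : ℝ) ^ (-(η * n * (J - j)))) * C := by
        rw [← Finset.sum_mul, ← Finset.mul_sum]
    _ ≤ a ^ n * 2 * 2 ^ (J * n) * C * C := by
        gcongr
        exact H F J fun j hj => Nat.cast_le.2 (hF j hj)
    _ = _ := by ring

end Sums

/-! ### Elementary counting of matrix entries. -/

section Entries

theorem ncard_setOf_eq_sum {α : Type*} [Fintype α] (p : α → Prop) [DecidablePred p] :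
    {x | p x}.ncard = ∑ x, if p x then 1 else 0 := by
  rw [← Finset.card_filter, ← Set.ncard_coe_finset]
  simp

theorem ncard_sigma {ι : Type*} [Fintype ι] {β : ι → Type*} [∀ i, Fintype (β i)]
    (p : (Σ i, β i) → Prop) : {x | p x}.ncard = ∑ i, {y | p ⟨i, y⟩}.ncard := by
  classical
  simp only [ncard_setOf_eq_sum, Fintype.sum_sigma]

variable {m m' : Type*}

theorem nnz_eq_sum [Fintype m] [Fintype m'] (B : Matrix m m' ℝ) :
    nnz B = ∑ i, {j | B i j ≠ 0}.ncard := by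
  classical
  rw [nnz]
  simp only [ncard_setOf_eq_sum, Fintype.sum_prod_type]

theorem nnz_le [Fintype m] [Fintype m'] {B : Matrix m m' ℝ} {c : ℝ}
    (h : ∀ i, ({j | B i j ≠ 0}.ncard : ℝ) ≤ c) :
    (nnz B : ℝ) ≤ Fintype.card m * c := by
  rw [nnz_eq_sum, Nat.cast_sum, ← nsmul_eq_mul]
  exact Finset.sum_le_card_nsmul _ _ _ fun i _ => h i

theorem nnzRow_le [Fintype m] {B : Matrix m m' ℝ} {c : ℝ} (hc : 0 ≤ c)
    (h : ∀ i, ({j | B i j ≠ 0}.ncard : ℝ) ≤ c) : (nnzRow B : ℝ) ≤ c := by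
  refine (Nat.cast_le.2 (Finset.sup_le (a := ⌊c⌋₊) fun i _ => Nat.le_floor (h i))).trans ?_
  exact Nat.floor_le hc

theorem nnzCol_le [Fintype m'] {B : Matrix m m' ℝ} {c : ℝ} (hc : 0 ≤ c)
    (h : ∀ j, ({i | B i j ≠ 0}.ncard : ℝ) ≤ c) : (nnzCol B : ℝ) ≤ c :=
  nnzRow_le (B := B.transpose) hc h

theorem le_nnzRow [Fintype m] (B : Matrix m m' ℝ) (i : m) : {j | B i j ≠ 0}.ncard ≤ nnzRow B :=
  Finset.le_sup (f := fun i => {j | B i j ≠ 0}.ncard) (Finset.mem_univ i)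

theorem ncard_row_le [Fintype m'] (B : Matrix m m' ℝ) (i : m) :
    {j | B i j ≠ 0}.ncard ≤ Fintype.card m' := by
  rw [← Nat.card_eq_fintype_card]
  exact Set.ncard_le_card _

theorem ncard_col_le [Fintype m] (B : Matrix m m' ℝ) (j : m') :
    {i | B i j ≠ 0}.ncard ≤ Fintype.card m :=
  ncard_row_le B.transpose j

end Entries

/-! ### Shifted parameters and the regimes of the threshold. -/

section Parameters

variable {P : Params} {n J : ℕ} {a : ℝ}

theorem Params.level_eq (P : Params) (J j j' : ℕ) : P.level J j j' =
    levelExp (P.t - P.r / 2) (P.t' - P.r / 2) (P.dd + P.r / 2) J j j' := by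
  simp only [Params.level, levelExp]; ring

theorem Params.tau_eq (P : Params) (J : ℕ) (a : ℝ) (j j' : ℕ) : P.tau J a j j' =
    threshold (P.t - P.r / 2) (P.t' - P.r / 2) (P.dd + P.r / 2) a J j j' := by
  rw [Params.tau, threshold, Params.level_eq]
  congr 4
  ring

theorem Params.slopeCond_iff (hA : 0 < P.σ - n / 2 + (P.t - P.r / 2))
    (hB : 0 < P.σ - n / 2 + (P.t' - P.r / 2)) (j j' : ℕ) :
    SlopeCond (P.t - P.r / 2) (P.t' - P.r / 2) (P.σ - n / 2) J j j' ↔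
      (j : ℝ) ≤ P.slopeRow n J j' ∧ (j' : ℝ) ≤ P.slopeCol n J j := by
  rw [SlopeCond, Params.slopeRow, Params.slopeCol]
  have e1 : P.σ - n / 2 + P.t' - P.r / 2 = P.σ - n / 2 + (P.t' - P.r / 2) := by ring
  have e2 : P.σ - n / 2 + P.t - P.r / 2 = P.σ - n / 2 + (P.t - P.r / 2) := by ring
  have e3 : P.t + P.t' - P.r = P.t - P.r / 2 + (P.t' - P.r / 2) := by ring
  rw [e1, e2, e3, div_mul_eq_mul_div, div_mul_eq_mul_div, div_mul_eq_mul_div, div_mul_eq_mul_div,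
    ← add_div, ← add_div, le_div_iff₀ hB, le_div_iff₀ hA]

/-- Below the line `j = β(j')` the threshold is determined by the level exponent. -/
theorem Params.le_cutRow_iff (hD : 0 < P.dd + P.t') (j j' : ℕ) :
    (j : ℝ) ≤ P.cutRow J j' ↔ -((2 * P.dd + P.r) * j') ≤ P.level J j j' := by
  rw [Params.cutRow, Params.level, div_mul_eq_mul_div, div_mul_eq_mul_div, ← add_div,
    le_div_iff₀ hD]
  constructor <;> intro h <;> linarith

theorem Params.cutRow_le_iff (hD : 0 < P.dd + P.t') (j j' : ℕ) :
    P.cutRow J j' ≤ (j : ℝ) ↔ P.level J j j' ≤ -((2 * P.dd + P.r) * j') := by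
  rw [Params.cutRow, Params.level, div_mul_eq_mul_div, div_mul_eq_mul_div, ← add_div,
    div_le_iff₀ hD]
  constructor <;> intro h <;> linarith

theorem Params.le_cutCol_iff (hD : 0 < P.dd + P.t) (j j' : ℕ) :
    (j' : ℝ) ≤ P.cutCol J j ↔ -((2 * P.dd + P.r) * j) ≤ P.level J j j' := by
  rw [Params.cutCol, Params.level, div_mul_eq_mul_div, div_mul_eq_mul_div, ← add_div,
    le_div_iff₀ hD]
  constructor <;> intro h <;> linarith

theorem Params.cutCol_le_iff (hD : 0 < P.dd + P.t) (j j' : ℕ) :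
    P.cutCol J j ≤ (j' : ℝ) ↔ P.level J j j' ≤ -((2 * P.dd + P.r) * j) := by
  rw [Params.cutCol, Params.level, div_mul_eq_mul_div, div_mul_eq_mul_div, ← add_div,
    div_le_iff₀ hD]
  constructor <;> intro h <;> linarith

theorem Params.tau_of_level_le (hD : 0 < 2 * P.dd + P.r) {j j' : ℕ}
    (h : P.level J j j' ≤ -((2 * P.dd + P.r) * (min j j' : ℕ))) :
    P.tau J a j j' = a * (2 : ℝ) ^ (-(min j j' : ℕ) : ℝ) := by
  rw [Params.tau, max_eq_left]
  refine Real.rpow_le_rpow_of_exponent_le one_le_two ?_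
  rw [div_le_iff₀ hD]
  linarith

theorem Params.tau_of_le_level (hD : 0 < 2 * P.dd + P.r) {j j' : ℕ}
    (h : -((2 * P.dd + P.r) * (min j j' : ℕ)) ≤ P.level J j j') :
    P.tau J a j j' = a * (2 : ℝ) ^ (P.level J j j' / (2 * P.dd + P.r)) := by
  rw [Params.tau, max_eq_right]
  refine Real.rpow_le_rpow_of_exponent_le one_le_two ?_
  rw [le_div_iff₀ hD]
  linarith

end Parameters

/-! ### Rows, columns and total of the mask. -/

section Blocks

variable {M : Type*} [MetricSpace M] [MeasurableSpace M] [BorelSpace M] {n : ℕ}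
  {κ : ℕ → Type*} [∀ j, Fintype (κ j)] (W : BiorthogonalWavelets M n κ) {P : Params} {a : ℝ} {J : ℕ}

theorem BiorthogonalWavelets.mask_ne_zero_iff (l l' : TruncIndex κ W.j₀ J) :
    W.mask P a J l l' ≠ 0 ↔ (l, l') ∈ W.retained P a J := by
  classical
  simp [BiorthogonalWavelets.mask]

/-- The coarser of the two scales is built into the threshold; this supplies both scale conditions
of the counting bound. -/
theorem inv_two_pow_le_tau (ha : 1 ≤ a) (j j' : ℕ) :
    ((2 : ℝ) ^ j)⁻¹ ≤ P.tau J a j j' ∧ ((2 : ℝ) ^ j')⁻¹ ≤ P.tau J a j j' := by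
  have h : ∀ i : ℕ, min j j' ≤ i → ((2 : ℝ) ^ i)⁻¹ ≤ P.tau J a j j' := fun i hi => by
    rw [Params.tau_eq]
    refine le_trans ?_ (two_rpow_neg_min_le_threshold ha J j j')
    rw [← Real.rpow_natCast, ← Real.rpow_neg zero_le_two]
    refine Real.rpow_le_rpow_of_exponent_le one_le_two ?_
    exact neg_le_neg (Nat.cast_le.2 hi)
  exact ⟨h j (min_le_left _ _), h j' (min_le_right _ _)⟩

/-- A bound for the number of wavelets of a level whose hulls are close to a given one. -/
def BiorthogonalWavelets.CountBound (W : BiorthogonalWavelets M n κ) (K : ℝ) : Prop :=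
  ∀ (l : WaveletIndex κ W.j₀) (j' : Set.Ici W.j₀) (τ : ℝ),
    ((2 : ℝ) ^ (l.1 : ℕ))⁻¹ ≤ τ → ((2 : ℝ) ^ (j' : ℕ))⁻¹ ≤ τ →
    ({k' : κ j' | setDist (W.hull l) (W.hull ⟨j', k'⟩) ≤ τ}.ncard : ℝ) ≤
      K * (2 ^ ((j' : ℕ) * n) * τ ^ n)

variable {W} {K : ℝ}

theorem BiorthogonalWavelets.CountBound.row (hK : W.CountBound K) (ha : 1 ≤ a)
    (l : TruncIndex κ W.j₀ J) (j' : Finset.Icc W.j₀ J) :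
    ({k' : κ j' | W.mask P a J l ⟨j', k'⟩ ≠ 0}.ncard : ℝ) ≤
      K * (2 ^ ((j' : ℕ) * n) * P.tau J a l.1 j' ^ n) := by
  have h := inv_two_pow_le_tau (P := P) (J := J) ha l.1 j'
  refine le_trans (Nat.cast_le.2 ?_)
    (hK l.toIndex ⟨j', (Finset.mem_Icc.1 j'.2).1⟩ _ h.1 h.2)
  refine Set.ncard_le_ncard (fun k' hk' => ?_) (Set.toFinite _)
  exact ((W.mask_ne_zero_iff _ _).1 hk').1

theorem BiorthogonalWavelets.CountBound.col (hK : W.CountBound K) (ha : 1 ≤ a)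
    (l' : TruncIndex κ W.j₀ J) (j : Finset.Icc W.j₀ J) :
    ({k : κ j | W.mask P a J ⟨j, k⟩ l' ≠ 0}.ncard : ℝ) ≤
      K * (2 ^ ((j : ℕ) * n) * P.tau J a j l'.1 ^ n) := by
  have h := inv_two_pow_le_tau (P := P) (J := J) ha j l'.1
  refine le_trans (Nat.cast_le.2 ?_)
    (hK l'.toIndex ⟨j, (Finset.mem_Icc.1 j.2).1⟩ _ h.2 h.1)
  refine Set.ncard_le_ncard (fun k hk => ?_) (Set.toFinite _)
  have := ((W.mask_ne_zero_iff _ _).1 hk).1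
  rwa [setDist_comm] at this

/-- The number of nonzero entries of the mask in a row. -/
theorem BiorthogonalWavelets.CountBound.row_total (hK : W.CountBound K) (ha : 1 ≤ a)
    {Q : ℕ → ℕ → Prop} [∀ j j', Decidable (Q j j')]
    (hQ : ∀ j j' : ℕ, (j : ℝ) ≤ P.slopeRow n J j' ∧ (j' : ℝ) ≤ P.slopeCol n J j → Q j j')
    (l : TruncIndex κ W.j₀ J) :
    ({l' | W.mask P a J l l' ≠ 0}.ncard : ℝ) ≤
      K * ∑ j' ∈ (Finset.Icc W.j₀ J).filter (Q l.1), 2 ^ (j' * n) * P.tau J a l.1 j' ^ n := by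
  rw [ncard_sigma, Nat.cast_sum, Finset.mul_sum, Finset.sum_filter,
    ← Finset.sum_coe_sort (Finset.Icc W.j₀ J)]
  refine Finset.sum_le_sum fun j' _ => ?_
  split_ifs with h
  · exact hK.row ha l j'
  · refine le_of_eq ?_
    rw [Nat.cast_eq_zero, Set.ncard_eq_zero (Set.toFinite _)]
    refine Set.eq_empty_of_forall_notMem fun k' hk' => h ?_
    exact hQ _ _ ((W.mask_ne_zero_iff _ _).1 hk').2

theorem BiorthogonalWavelets.CountBound.col_total (hK : W.CountBound K) (ha : 1 ≤ a)
    {Q : ℕ → ℕ → Prop} [∀ j j', Decidable (Q j j')]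
    (hQ : ∀ j j' : ℕ, (j : ℝ) ≤ P.slopeRow n J j' ∧ (j' : ℝ) ≤ P.slopeCol n J j → Q j j')
    (l' : TruncIndex κ W.j₀ J) :
    ({l | W.mask P a J l l' ≠ 0}.ncard : ℝ) ≤
      K * ∑ j ∈ (Finset.Icc W.j₀ J).filter (Q · l'.1), 2 ^ (j * n) * P.tau J a j l'.1 ^ n := by
  rw [ncard_sigma, Nat.cast_sum, Finset.mul_sum, Finset.sum_filter,
    ← Finset.sum_coe_sort (Finset.Icc W.j₀ J)]
  refine Finset.sum_le_sum fun j _ => ?_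
  split_ifs with h
  · exact hK.col ha l' j
  · refine le_of_eq ?_
    rw [Nat.cast_eq_zero, Set.ncard_eq_zero (Set.toFinite _)]
    refine Set.eq_empty_of_forall_notMem fun k hk => h ?_
    exact hQ _ _ ((W.mask_ne_zero_iff _ _).1 hk).2

/-- The number of nonzero entries of the mask. -/
theorem BiorthogonalWavelets.CountBound.total (hK : W.CountBound K) (ha : 1 ≤ a)
    {Q : ℕ → ℕ → Prop} [∀ j j', Decidable (Q j j')]
    (hQ : ∀ j j' : ℕ, (j : ℝ) ≤ P.slopeRow n J j' ∧ (j' : ℝ) ≤ P.slopeCol n J j → Q j j')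
    (hK0 : 0 ≤ K) {Ck : ℝ}
    (hCk : ∀ j : ℕ, W.j₀ ≤ j → (Fintype.card (κ j) : ℝ) ≤ Ck * 2 ^ (j * n)) :
    (nnz (W.mask P a J) : ℝ) ≤
      Ck * K * ∑ j ∈ Finset.Icc W.j₀ J, ∑ j' ∈ (Finset.Icc W.j₀ J).filter (Q j),
        2 ^ ((j + j') * n) * P.tau J a j j' ^ n := by
  rw [nnz_eq_sum, Nat.cast_sum, Fintype.sum_sigma, Finset.mul_sum,
    ← Finset.sum_coe_sort (Finset.Icc W.j₀ J)]
  refine Finset.sum_le_sum fun j _ => ?_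
  have hrow : ∀ k : κ j, ({l' | W.mask P a J ⟨j, k⟩ l' ≠ 0}.ncard : ℝ) ≤
      K * ∑ j' ∈ (Finset.Icc W.j₀ J).filter (Q j), 2 ^ (j' * n) * P.tau J a j j' ^ n :=
    fun k => hK.row_total ha hQ ⟨j, k⟩
  refine (Finset.sum_le_card_nsmul _ _ _ fun k _ => hrow k).trans ?_
  rw [nsmul_eq_mul, Finset.card_univ]
  have hτ : ∀ j' : ℕ, 0 ≤ P.tau J a j j' := fun j' =>
    le_trans (by positivity) (inv_two_pow_le_tau (P := P) (J := J) ha j j').1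
  have h0 : 0 ≤ ∑ j' ∈ (Finset.Icc W.j₀ J).filter (Q j), 2 ^ (j' * n) * P.tau J a j j' ^ n :=
    Finset.sum_nonneg fun j' _ => mul_nonneg (by positivity) (pow_nonneg (hτ j') n)
  refine (mul_le_mul_of_nonneg_right (hCk j (Finset.mem_Icc.1 j.2).1) (by positivity)).trans_eq ?_
  have h1 : ∑ j' ∈ (Finset.Icc W.j₀ J).filter (Q j),
        2 ^ (((j : ℕ) + j') * n) * P.tau J a j j' ^ n =
      2 ^ ((j : ℕ) * n) * ∑ j' ∈ (Finset.Icc W.j₀ J).filter (Q j),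
        2 ^ (j' * n) * P.tau J a j j' ^ n := by
    rw [Finset.mul_sum]
    refine Finset.sum_congr rfl fun j' _ => ?_
    rw [add_mul, pow_add, mul_assoc]
  rw [h1]
  ring

end Blocks

/-! ### Bounds for single blocks. -/

section BlockBounds

theorem setDist_le_diam {M : Type*} [MetricSpace M] [CompactSpace M] (A B : Set M) :
    setDist A B ≤ Metric.diam (univ : Set M) := by
  rcases (image2 dist A B).eq_empty_or_nonempty with h | ⟨d, x, hx, y, hy, rfl⟩
  -- With no distances to compare, the real infimum takes its default value `0`.
  · rw [setDist, h, Real.sInf_empty]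
    exact Metric.diam_nonneg
  · refine (csInf_le (a := dist x y) ⟨0, ?_⟩ (mem_image2_of_mem hx hy)).trans
      (Metric.dist_le_diam_of_mem isCompact_univ.isBounded (mem_univ x) (mem_univ y))
    rintro _ ⟨x, -, y, -, rfl⟩
    exact dist_nonneg

theorem two_pow_mul_threshold_pow (a : ℝ) (i i' n : ℕ) :
    (2 : ℝ) ^ (i * n) * (a * (2 : ℝ) ^ (-(i' : ℝ))) ^ n =
      a ^ n * (2 : ℝ) ^ (((i : ℝ) - (i' : ℝ)) * n) := by
  rw [mul_pow, ← Real.rpow_mul_natCast zero_le_two, ← Real.rpow_natCast 2 (i * n), mul_left_comm,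
    ← Real.rpow_add zero_lt_two]
  congr 2
  push_cast
  ring

theorem two_pow_mul_threshold_pow_self (a : ℝ) (i n : ℕ) :
    (2 : ℝ) ^ (i * n) * (a * (2 : ℝ) ^ (-(i : ℝ))) ^ n = a ^ n := by
  rw [two_pow_mul_threshold_pow, sub_self, zero_mul, Real.rpow_zero, mul_one]

variable {M : Type*} [MetricSpace M] [MeasurableSpace M] [BorelSpace M] {n : ℕ}
  {κ : ℕ → Type*} [∀ j, Fintype (κ j)] {W : BiorthogonalWavelets M n κ} {P : Params} {a K : ℝ}
  {J : ℕ}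

theorem tau_nonneg (ha : 1 ≤ a) (j j' : ℕ) : 0 ≤ P.tau J a j j' :=
  le_trans (by positivity) (inv_two_pow_le_tau (P := P) (J := J) ha j j').1

theorem BiorthogonalWavelets.CountBound.nnzRow_block_le (hK : W.CountBound K) (hK0 : 0 ≤ K)
    (ha : 1 ≤ a) (j j' : Finset.Icc W.j₀ J) :
    (nnzRow (block (W.mask P a J) j j') : ℝ) ≤
      K * (2 ^ ((j' : ℕ) * n) * P.tau J a j j' ^ n) :=
  nnzRow_le (mul_nonneg hK0 (mul_nonneg (by positivity) (pow_nonneg (tau_nonneg ha _ _) n)))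
    fun k => hK.row ha ⟨j, k⟩ j'

theorem BiorthogonalWavelets.CountBound.nnzCol_block_le (hK : W.CountBound K) (hK0 : 0 ≤ K)
    (ha : 1 ≤ a) (j j' : Finset.Icc W.j₀ J) :
    (nnzCol (block (W.mask P a J) j j') : ℝ) ≤
      K * (2 ^ ((j : ℕ) * n) * P.tau J a j j' ^ n) :=
  nnzCol_le (mul_nonneg hK0 (mul_nonneg (by positivity) (pow_nonneg (tau_nonneg ha _ _) n)))
    fun k' => hK.col ha ⟨j', k'⟩ j

theorem BiorthogonalWavelets.CountBound.nnz_block_le (hK : W.CountBound K) (hK0 : 0 ≤ K)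
    (ha : 1 ≤ a) {Ck : ℝ}
    (hCk : ∀ j : ℕ, W.j₀ ≤ j → (Fintype.card (κ j) : ℝ) ≤ Ck * 2 ^ (j * n))
    (j j' : Finset.Icc W.j₀ J) :
    (nnz (block (W.mask P a J) j j') : ℝ) ≤
      Ck * K * (2 ^ ((j : ℕ) * n) * (2 ^ ((j' : ℕ) * n) * P.tau J a j j' ^ n)) := by
  have hrow : ∀ k : κ j, ({k' | block (W.mask P a J) j j' k k' ≠ 0}.ncard : ℝ) ≤
      K * (2 ^ ((j' : ℕ) * n) * P.tau J a j j' ^ n) := fun k => hK.row ha ⟨j, k⟩ j'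
  refine (nnz_le hrow).trans ?_
  have h0 := pow_nonneg (tau_nonneg (P := P) (J := J) ha j j') n
  refine (mul_le_mul_of_nonneg_right (hCk j (Finset.mem_Icc.1 j.2).1) (by positivity)).trans_eq ?_
  ring

/-- The mask vanishes where a slope condition fails. -/
theorem block_mask_eq_zero {j j' : Finset.Icc W.j₀ J}
    (h : P.slopeRow n J j' < (j : ℕ) ∨ P.slopeCol n J j < (j' : ℕ)) :
    block (W.mask P a J) j j' = 0 := by
  ext k k'
  by_contra hne
  have := ((W.mask_ne_zero_iff ⟨j, k⟩ ⟨j', k'⟩).1 hne).2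
  rcases h with h | h
  · exact absurd this.1 (not_le.2 h)
  · exact absurd this.2 (not_le.2 h)

/-- The mask is full where the level exponent is nonnegative. -/
theorem block_mask_eq_one [CompactSpace M] (ha : Metric.diam (univ : Set M) ≤ a) (ha0 : 0 ≤ a)
    (hD : 0 < 2 * P.dd + P.r) {j j' : Finset.Icc W.j₀ J} (hlev : 0 ≤ P.level J j j')
    (h : ((j : ℕ) : ℝ) ≤ P.slopeRow n J j' ∧ ((j' : ℕ) : ℝ) ≤ P.slopeCol n J j) (k : κ j)
    (k' : κ j') : W.mask P a J ⟨j, k⟩ ⟨j', k'⟩ = 1 := by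
  have hr : ((⟨j, k⟩, ⟨j', k'⟩) : TruncIndex κ W.j₀ J × TruncIndex κ W.j₀ J) ∈
      W.retained P a J := by
    refine ⟨(setDist_le_diam _ _).trans (ha.trans ?_), h⟩
    have h1 : (1 : ℝ) ≤ (2 : ℝ) ^ (P.level J j j' / (2 * P.dd + P.r)) :=
      Real.one_le_rpow one_le_two (by positivity)
    exact le_mul_of_one_le_right ha0 (h1.trans (le_max_right _ _))
  rw [BiorthogonalWavelets.mask, if_pos hr]

end BlockBounds

end WaveletCompression

end

/-! ### The main theorem. -/

set_option maxHeartbeats 2000000 in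
open WaveletCompression in
theorem propositionC2
    {n : ℕ} (hn : 0 < n)
    {M : Type*} [MetricSpace M] [CompactSpace M] [ConnectedSpace M]
    [ChartedSpace (EuclideanSpace ℝ (Fin n)) M] [IsManifold (𝓡 n) ∞ M]
    [Bundle.RiemannianBundle (fun x : M => TangentSpace (𝓡 n) x)]
    [IsContMDiffRiemannianBundle (𝓡 n) ∞ (EuclideanSpace ℝ (Fin n))
      (fun x : M => TangentSpace (𝓡 n) x)]
    [IsRiemannianManifold (𝓡 n) M]
    [MeasurableSpace M] [BorelSpace M]
    {κ : ℕ → Type*} [∀ j, Fintype (κ j)] (W : BiorthogonalWavelets M n κ) :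
    ∃ a₀ : ℝ, 1 < a₀ ∧
    ∀ P : Params,
      P.r / 2 < P.t → P.r / 2 < P.t' →
      n / 2 + max P.t P.t' - P.r / 2 < P.σ → P.σ < P.dd + n / 2 + P.r / 2 →
    ∀ a : ℝ, a₀ ≤ a →
    ∃ C : ℝ, 0 < C ∧ ∀ J : ℕ, W.j₀ < J →
      (∀ j j' : Finset.Icc W.j₀ J,
        (((j : ℕ), (j' : ℕ)) ∈ P.D₁ n J ∪ P.D₂ n J →
          nnz (block (W.mask P a J) j j') = 0 ∧
          nnzRow (block (W.mask P a J) j j') = 0 ∧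
          nnzCol (block (W.mask P a J) j j') = 0) ∧
        (((j : ℕ), (j' : ℕ)) ∈ P.D₃ n J →
          (C⁻¹ * (2 : ℝ) ^ (-(j' : ℕ) : ℝ) ≤ P.tau J a j j' ∧
            P.tau J a j j' ≤ C * (2 : ℝ) ^ (-(j' : ℕ) : ℝ)) ∧
          (nnz (block (W.mask P a J) j j') : ℝ) ≤ C * 2 ^ ((j : ℕ) * n) ∧
          (nnzRow (block (W.mask P a J) j j') : ℝ) ≤ C ∧
          (nnzCol (block (W.mask P a J) j j') : ℝ) ≤ C * (2 : ℝ) ^ (((j : ℕ) - (j' : ℕ) : ℝ) * n)) ∧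
        (((j : ℕ), (j' : ℕ)) ∈ P.D₄ n J →
          (C⁻¹ * (2 : ℝ) ^ (-(j : ℕ) : ℝ) ≤ P.tau J a j j' ∧
            P.tau J a j j' ≤ C * (2 : ℝ) ^ (-(j : ℕ) : ℝ)) ∧
          (nnz (block (W.mask P a J) j j') : ℝ) ≤ C * 2 ^ ((j' : ℕ) * n) ∧
          (nnzRow (block (W.mask P a J) j j') : ℝ) ≤ C * (2 : ℝ) ^ (((j' : ℕ) - (j : ℕ) : ℝ) * n) ∧
          (nnzCol (block (W.mask P a J) j j') : ℝ) ≤ C) ∧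
        (((j : ℕ), (j' : ℕ)) ∈ P.D₅ J →
          (C⁻¹ * (2 : ℝ) ^ (P.level J j j' / (2 * P.dd + P.r)) ≤ P.tau J a j j' ∧
            P.tau J a j j' ≤ C * (2 : ℝ) ^ (P.level J j j' / (2 * P.dd + P.r))) ∧
          (nnz (block (W.mask P a J) j j') : ℝ) ≤
            C * (2 ^ (((j : ℕ) + (j' : ℕ)) * n) * P.tau J a j j' ^ n) ∧
          (nnzRow (block (W.mask P a J) j j') : ℝ) ≤
            C * (2 ^ ((j' : ℕ) * n) * P.tau J a j j' ^ n) ∧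
          (nnzCol (block (W.mask P a J) j j') : ℝ) ≤
            C * (2 ^ ((j : ℕ) * n) * P.tau J a j j' ^ n)) ∧
        (((j : ℕ), (j' : ℕ)) ∈ P.D₆ J →
          (∀ A : Matrix (WaveletIndex κ W.j₀) (WaveletIndex κ W.j₀) ℝ,
            block (W.compress P a J A) j j' = block (W.truncate J A) j j') ∧
          (nnz (block (W.mask P a J) j j') : ℝ) ≤ C * 2 ^ (((j : ℕ) + (j' : ℕ)) * n) ∧
          (C⁻¹ * 2 ^ ((j' : ℕ) * n) ≤ (nnzRow (block (W.mask P a J) j j') : ℝ) ∧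
            (nnzRow (block (W.mask P a J) j j') : ℝ) ≤ C * 2 ^ ((j' : ℕ) * n)) ∧
          (nnzCol (block (W.mask P a J) j j') : ℝ) ≤ C * 2 ^ ((j : ℕ) * n))) ∧
      (C⁻¹ * 2 ^ (J * n) ≤ (Fintype.card (TruncIndex κ W.j₀ J) : ℝ) ∧
        (Fintype.card (TruncIndex κ W.j₀ J) : ℝ) ≤ C * 2 ^ (J * n)) ∧
      (nnz (W.mask P a J) : ℝ) ≤ C * 2 ^ (J * n) ∧
      (nnzRow (W.mask P a J) : ℝ) ≤
        C * (2 : ℝ) ^ (J * n * (P.t + P.t' - P.r) / (P.σ - n / 2 + P.t - P.r / 2)) ∧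
      (nnzCol (W.mask P a J) : ℝ) ≤
        C * (2 : ℝ) ^ (J * n * (P.t + P.t' - P.r) / (P.σ - n / 2 + P.t' - P.r / 2)) := by
  classical
  obtain ⟨CH, hCH, hH⟩ := exists_dist_geodesicHull_le n M
  obtain ⟨CV, hCV, hV⟩ := exists_volume_le n M
  obtain ⟨K, hK0, hK⟩ := W.exists_ncard_le hCH hH hCV hV
  replace hK : W.CountBound K := hK
  obtain ⟨Ck, hCk0, hCk⟩ := W.card_level
  have hCku : ∀ j : ℕ, W.j₀ ≤ j → (Fintype.card (κ j) : ℝ) ≤ Ck * 2 ^ (j * n) :=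
    fun j hj => (hCk j hj).2
  have hdiam : 0 ≤ Metric.diam (univ : Set M) := Metric.diam_nonneg
  -- The diameter makes the blocks of `D₆` full; the `2` ensures `a₀ > 1`. No dependence on `P` is
  -- needed.
  refine ⟨Metric.diam (univ : Set M) + 2, by linarith, ?_⟩
  intro P ht ht' hσ hσd a ha
  have ha1 : 1 ≤ a := by linarith
  have ha0 : 0 < a := by linarith
  -- the shifted parameters
  have hA : 0 < P.t - P.r / 2 := by linarith
  have hB : 0 < P.t' - P.r / 2 := by linarith
  have hAS : P.t - P.r / 2 < P.σ - n / 2 := by linarith [le_max_left P.t P.t']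
  have hBS : P.t' - P.r / 2 < P.σ - n / 2 := by linarith [le_max_right P.t P.t']
  have hSD : P.σ - n / 2 < P.dd + P.r / 2 := by linarith
  have hD : 0 < 2 * P.dd + P.r := by linarith
  have hslope := fun J : ℕ => Params.slopeCond_iff (P := P) (n := n) (J := J)
    (by linarith) (by linarith)
  obtain ⟨C₁, hC₁, H₁⟩ := exists_row_sum_le hn hA hB hAS hSD ha0
  obtain ⟨C₂, hC₂, H₂⟩ := exists_row_sum_le hn hB hA hBS hSD ha0
  obtain ⟨C₃, hC₃, H₃⟩ := exists_total_sum_le hn hA hB hAS hBS hSD ha0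
  obtain ⟨C₄, hC₄, H₄⟩ := exists_sum_two_rpow_le (x := n) (Nat.cast_pos.2 hn)
  obtain ⟨C, hC1, ha_le, hCk_le, hK_le, hKa_le, hCkK_le, hCkKa_le, hCk2_le, h4_le, h1_le, h2_le,
      h3_le⟩ : ∃ C : ℝ, 1 ≤ C ∧ a ≤ C ∧ Ck ≤ C ∧ K ≤ C ∧ K * a ^ n ≤ C ∧ Ck * K ≤ C ∧
      Ck * K * a ^ n ≤ C ∧ Ck * Ck ≤ C ∧ Ck * C₄ ≤ C ∧ K * C₁ ≤ C ∧ K * C₂ ≤ C ∧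
      Ck * K * C₃ ≤ C := by
    have i1 : 0 ≤ K * a ^ n := by positivity
    have i2 : 0 ≤ Ck * K := by positivity
    have i3 : 0 ≤ Ck * K * a ^ n := by positivity
    have i4 : 0 ≤ Ck * Ck := by positivity
    have i5 : 0 ≤ Ck * C₄ := by positivity
    have i6 : 0 ≤ K * C₁ := by positivity
    have i7 : 0 ≤ K * C₂ := by positivity
    have i8 : 0 ≤ Ck * K * C₃ := by positivity
    refine ⟨1 + a + Ck + K + K * a ^ n + Ck * K + Ck * K * a ^ n + Ck * Ck + Ck * C₄ + K * C₁ +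
      K * C₂ + Ck * K * C₃, ?_, ?_, ?_, ?_, ?_, ?_, ?_, ?_, ?_, ?_, ?_, ?_⟩ <;> linarith
  have hC0 : 0 < C := by linarith
  have hCinv : C⁻¹ ≤ a := (inv_le_one_of_one_le₀ hC1).trans ha1
  have hCkinv : C⁻¹ ≤ Ck⁻¹ := inv_anti₀ hCk0 hCk_le
  refine ⟨C, hC0, fun J hJ => ⟨fun j j' => ⟨?_, ?_, ?_, ?_, ?_⟩, ⟨?_, ?_⟩, ?_, ?_, ?_⟩⟩
  · intro h
    have hz : block (W.mask P a J) j j' = 0 := block_mask_eq_zero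
      (h.imp (fun h => h.2.2) fun h => h.2.2)
    rw [hz]
    simp [nnz, nnzRow, nnzCol]
  · rintro ⟨-, hlt, -, hcut⟩
    have hmin : min (j : ℕ) (j' : ℕ) = j' := min_eq_right hlt.le
    have hτ : P.tau J a j j' = a * (2 : ℝ) ^ (-((j' : ℕ) : ℝ)) := by
      rw [Params.tau_of_level_le hD (by
        rw [hmin]; exact (Params.cutRow_le_iff (by linarith) _ _).1 hcut), hmin]
    have hT := hK.nnz_block_le (P := P) hK0.le ha1 hCku j j'
    have hR := hK.nnzRow_block_le (P := P) hK0.le ha1 j j'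
    have hCo := hK.nnzCol_block_le (P := P) hK0.le ha1 j j'
    rw [hτ, two_pow_mul_threshold_pow_self] at hT hR
    rw [hτ, two_pow_mul_threshold_pow] at hCo
    rw [hτ]
    refine ⟨⟨by gcongr, by gcongr⟩, hT.trans ?_, hR.trans hKa_le, hCo.trans ?_⟩
    · calc Ck * K * (2 ^ ((j : ℕ) * n) * a ^ n) = Ck * K * a ^ n * 2 ^ ((j : ℕ) * n) := by ring
        _ ≤ _ := by gcongr
    · rw [← mul_assoc]
      gcongr
  · rintro ⟨-, hlt, -, hcut⟩
    have hmin : min (j : ℕ) (j' : ℕ) = j := min_eq_left hlt.le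
    have hτ : P.tau J a j j' = a * (2 : ℝ) ^ (-((j : ℕ) : ℝ)) := by
      rw [Params.tau_of_level_le hD (by
        rw [hmin]; exact (Params.cutCol_le_iff (by linarith) _ _).1 hcut), hmin]
    have hT := hK.nnz_block_le (P := P) hK0.le ha1 hCku j j'
    have hR := hK.nnzRow_block_le (P := P) hK0.le ha1 j j'
    have hCo := hK.nnzCol_block_le (P := P) hK0.le ha1 j j'
    -- Here the threshold has scale `2^{-j}`, so it cancels the factor of level `j`.
    rw [mul_left_comm (2 ^ ((j : ℕ) * n) : ℝ), hτ, two_pow_mul_threshold_pow_self] at hT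
    rw [hτ, two_pow_mul_threshold_pow_self] at hCo
    rw [hτ, two_pow_mul_threshold_pow] at hR
    rw [hτ]
    refine ⟨⟨by gcongr, by gcongr⟩, hT.trans ?_, hR.trans ?_, hCo.trans hKa_le⟩
    · calc Ck * K * (2 ^ ((j' : ℕ) * n) * a ^ n) = Ck * K * a ^ n * 2 ^ ((j' : ℕ) * n) := by ring
        _ ≤ _ := by gcongr
    · rw [← mul_assoc]
      gcongr
  · rintro ⟨-, h1, h2⟩
    have hτ : P.tau J a j j' = a * (2 : ℝ) ^ (P.level J j j' / (2 * P.dd + P.r)) := by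
      refine Params.tau_of_le_level hD ?_
      -- Each cut line compares the level exponent with one of the two scales; whichever is coarser,
      -- the level term attains the maximum.
      rcases min_choice (j : ℕ) (j' : ℕ) with h | h <;> rw [h]
      · exact (Params.le_cutCol_iff (by linarith) _ _).1 h2
      · exact (Params.le_cutRow_iff (by linarith) _ _).1 h1
    have hτ0 := pow_nonneg (tau_nonneg (P := P) (J := J) ha1 j j') n
    refine ⟨⟨?_, ?_⟩, ?_, ?_, ?_⟩
    · rw [hτ]; gcongr
    · rw [hτ]; gcongr
    · refine (hK.nnz_block_le hK0.le ha1 hCku j j').trans ?_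
      rw [add_mul, pow_add, mul_assoc ((2 : ℝ) ^ ((j : ℕ) * n))]
      gcongr
    · exact (hK.nnzRow_block_le hK0.le ha1 j j').trans (by gcongr)
    · exact (hK.nnzCol_block_le hK0.le ha1 j j').trans (by gcongr)
  · intro hlev
    replace hlev : 0 ≤ P.level J j j' := hlev
    have hj0 : (0 : ℝ) ≤ ((j : ℕ) : ℝ) := Nat.cast_nonneg _
    have hj0' : (0 : ℝ) ≤ ((j' : ℕ) : ℝ) := Nat.cast_nonneg _
    -- A nonnegative level exponent is stronger than both slope conditions, since `S < D` and the
    -- levels are nonnegative.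
    have hs : SlopeCond (P.t - P.r / 2) (P.t' - P.r / 2) (P.σ - n / 2) J j j' := by
      rw [Params.level_eq, levelExp] at hlev
      constructor
      · nlinarith
      · nlinarith
    have hone := block_mask_eq_one (W := W) (a := a) (by linarith) ha0.le hD hlev
      ((hslope J _ _).1 hs)
    have hb : block (W.mask P a J) j j' = fun _ _ => 1 := by
      ext k k'; exact hone k k'
    have hcj := hCk j (Finset.mem_Icc.1 j.2).1
    have hcj' := hCk j' (Finset.mem_Icc.1 j'.2).1
    have hne : Nonempty (κ j) := by
      rw [← Fintype.card_pos_iff]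
      have : (0 : ℝ) < Fintype.card (κ j) := lt_of_lt_of_le (by positivity) hcj.1
      exact_mod_cast this
    refine ⟨?_, ?_, ⟨?_, ?_⟩, ?_⟩
    · intro A
      ext k k'
      change W.mask P a J ⟨j, k⟩ ⟨j', k'⟩ * W.truncate J A ⟨j, k⟩ ⟨j', k'⟩ = _
      rw [hone, one_mul]
      rfl
    · refine (nnz_le fun k => Nat.cast_le.2 (ncard_row_le _ k)).trans ?_
      calc (Fintype.card (κ j) : ℝ) * Fintype.card (κ j')
          ≤ (Ck * 2 ^ ((j : ℕ) * n)) * (Ck * 2 ^ ((j' : ℕ) * n)) := by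
            gcongr
            · exact hcj.2
            · exact hcj'.2
        _ = Ck * Ck * 2 ^ (((j : ℕ) + (j' : ℕ)) * n) := by rw [add_mul, pow_add]; ring
        _ ≤ _ := by gcongr
    · have h1 := le_nnzRow (block (W.mask P a J) j j') (Classical.arbitrary (κ j))
      have h2 : {k' : κ j' | block (W.mask P a J) j j' (Classical.arbitrary (κ j)) k' ≠ 0} =
          univ := by
        rw [hb]; simp
      rw [h2, Set.ncard_univ, Nat.card_eq_fintype_card] at h1
      refine le_trans ?_ (Nat.cast_le.2 h1)
      exact le_trans (by gcongr) hcj'.1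
    · refine nnzRow_le (by positivity) fun k => ?_
      exact (Nat.cast_le.2 (ncard_row_le _ k)).trans (hcj'.2.trans (by gcongr))
    · refine nnzCol_le (by positivity) fun k' => ?_
      exact (Nat.cast_le.2 (ncard_col_le _ k')).trans (hcj.2.trans (by gcongr))
  · rw [Fintype.card_sigma, Nat.cast_sum]
    -- The finest level alone gives the lower bound.
    have h1 := (hCk J hJ.le).1
    have h2 := Finset.single_le_sum (f := fun j : Finset.Icc W.j₀ J => (Fintype.card (κ j) : ℝ))
      (fun j _ => Nat.cast_nonneg _) (Finset.mem_univ ⟨J, Finset.mem_Icc.2 ⟨hJ.le, le_rfl⟩⟩)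
    exact (le_trans (by gcongr) h1).trans h2
  · rw [Fintype.card_sigma, Nat.cast_sum,
      Finset.sum_coe_sort (Finset.Icc W.j₀ J) fun j => (Fintype.card (κ j) : ℝ)]
    have hterm : ∀ j ∈ Finset.Icc W.j₀ J, (Fintype.card (κ j) : ℝ) ≤
        Ck * 2 ^ (J * n) * (2 : ℝ) ^ (-((n : ℝ) * ((J : ℝ) - j))) := fun j hj => by
      refine (hCku j (Finset.mem_Icc.1 hj).1).trans_eq ?_
      rw [mul_assoc, ← Real.rpow_natCast, ← Real.rpow_natCast, ← Real.rpow_add zero_lt_two]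
      congr 2
      push_cast
      ring
    refine (Finset.sum_le_sum hterm).trans ?_
    rw [← Finset.mul_sum]
    calc Ck * 2 ^ (J * n) * ∑ j ∈ Finset.Icc W.j₀ J, (2 : ℝ) ^ (-((n : ℝ) * ((J : ℝ) - j)))
        ≤ Ck * 2 ^ (J * n) * C₄ := by
          gcongr
          exact H₄ _ _ fun j hj => Nat.cast_le.2 (Finset.mem_Icc.1 hj).2
      _ = Ck * C₄ * 2 ^ (J * n) := by ring
      _ ≤ _ := by gcongr
  · have h := hK.total (P := P) (J := J) ha1
      (Q := SlopeCond (P.t - P.r / 2) (P.t' - P.r / 2) (P.σ - n / 2) J)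
      (fun j j' h => (hslope J j j').2 h) hK0.le hCku
    have h' := H₃ J (Finset.Icc W.j₀ J) (fun j => (Finset.Icc W.j₀ J).filter
      (SlopeCond (P.t - P.r / 2) (P.t' - P.r / 2) (P.σ - n / 2) J j))
      (fun j hj => (Finset.mem_Icc.1 hj).2) fun j _ j' hj' =>
        ⟨(Finset.mem_Icc.1 (Finset.mem_filter.1 hj').1).2, (Finset.mem_filter.1 hj').2⟩
    simp only [Params.tau_eq] at h
    refine h.trans ((mul_le_mul_of_nonneg_left h' (by positivity)).trans ?_)
    rw [← mul_assoc]
    gcongr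
  · refine nnzRow_le (by positivity) fun l => ?_
    have h := hK.row_total (P := P) ha1
      (Q := SlopeCond (P.t - P.r / 2) (P.t' - P.r / 2) (P.σ - n / 2) J)
      (fun j j' h => (hslope J j j').2 h) l
    have h' := H₁ J l.1 ((Finset.Icc W.j₀ J).filter
      (SlopeCond (P.t - P.r / 2) (P.t' - P.r / 2) (P.σ - n / 2) J l.1))
      (Finset.mem_Icc.1 l.1.2).2 fun j' hj' =>
        ⟨(Finset.mem_Icc.1 (Finset.mem_filter.1 hj').1).2, (Finset.mem_filter.1 hj').2⟩
    simp only [Params.tau_eq] at h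
    refine h.trans ((mul_le_mul_of_nonneg_left h' hK0.le).trans ?_)
    have e1 : P.t - P.r / 2 + (P.t' - P.r / 2) = P.t + P.t' - P.r := by ring
    have e2 : P.σ - n / 2 + (P.t - P.r / 2) = P.σ - n / 2 + P.t - P.r / 2 := by ring
    rw [← mul_assoc, e1, e2]
    gcongr
  · refine nnzCol_le (by positivity) fun l => ?_
    have h := hK.col_total (P := P) ha1
      (Q := SlopeCond (P.t - P.r / 2) (P.t' - P.r / 2) (P.σ - n / 2) J)
      (fun j j' h => (hslope J j j').2 h) l
    -- Columns are rows with `A` and `B` interchanged.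
    have h' := H₂ J l.1 ((Finset.Icc W.j₀ J).filter
      (SlopeCond (P.t - P.r / 2) (P.t' - P.r / 2) (P.σ - n / 2) J · l.1))
      (Finset.mem_Icc.1 l.1.2).2 fun j hj =>
        ⟨(Finset.mem_Icc.1 (Finset.mem_filter.1 hj).1).2,
          (slopeCond_comm _ _ _ _ _ _).1 (Finset.mem_filter.1 hj).2⟩
    simp only [Params.tau_eq, threshold_comm (P.t - P.r / 2)] at h
    refine h.trans ((mul_le_mul_of_nonneg_left h' hK0.le).trans ?_)
    have e1 : P.t' - P.r / 2 + (P.t - P.r / 2) = P.t + P.t' - P.r := by ring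
    have e2 : P.σ - n / 2 + (P.t' - P.r / 2) = P.σ - n / 2 + P.t' - P.r / 2 := by ring
    rw [← mul_assoc, e1, e2]
    gcongr
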